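/- Let $n\ge 2$, $G=SL(n,\mathbb{C})$, $K=SU(n)$, and let $Z=G/K$ with base point $u=K$. Give $Z$ the $G$-invariant Riemannian metric which on $T_uZ\cong\mathfrak{p}=\{X\in \mathfrak{sl}(n,\mathbb{C}) : {}^t\overline{X}=X\}$ is the Killing form $B(X,Y)=4n\,\mathrm{Re}\,\mathrm{Tr}(XY)$, and let $Z(\infty)$ be the set of unit speed geodesic rays $\mathbb{R}_{\ge 0}\to Z$ modulo the relation of being asymptotic (having bounded distance), with its induced action of $G$. For a subspace $W$ of $\mathbb{C}^n$ with $0\ne W\ne\mathbb{C}^n$, let $z_W\in Z(\infty)$ be the point whose stabilizer in $G$ is the (maximal parabolic) stabilizer of $W$. A geodesic in $Z$ (a complete unit speed geodesic $\gamma:\mathbb{R}\to Z$) joins $z_W$ and $z_{W'}$ if the classes of the two rays $t\mapsto\gamma(t)$ and $t\mapsto\gamma(-t)$, $t\ge 0$, are $z_W$ and $z_{W'}$ in one of the two orders. Geodesics are identified up to reparametrization, i.e. $\gamma\sim\gamma'$ if $\gamma'(t)=\gamma(at+b)$ for all $t$, for some real $a\neq 0$ and $b$. Let $W,W'$ be subspaces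 of $\mathbb{C}^n$ with $W\oplus W'=\mathbb{C}^n$ and $r=\dim W$, $0<r<n$. Put $$\rho=\sqrt{\frac{n-r}{4rn^2}},\qquad \sigma=-\frac{r}{n-r}\,\rho .$$ Let $\{h\}$ and $\{h'\}$ be homothety classes (i.e. classes modulo positive real multiples) of hermitian metrics, that is, positive definite hermitian forms, on $W$ and on $W'$ respectively. Then there is an element $g\in G$ such that $ge_1,\dots,ge_r$ is an orthonormal basis of $W$ for some metric in $\{h\}$ and $ge_{r+1},\dots,ge_n$ is an orthonormal basis of $W'$ for some metric in $\{h'\}$, and for every such $g$ the curve $$\gamma(t)=g\,\exp\bigl(t\,\mathrm{diag}(\underbrace{\rho,\dots,\rho}_{r},\sigma,\dots,\sigma)\bigr)u,\qquad t\in\mathbb{R},$$ is a unit speed geodesic joining $z_W$ and $z_{W'}$. Up to reparametrization $\gamma$ does not depend on the choice of $g$, and the map $(\{h\},\{h'\})\mapsto[\gamma]$ is a bijection from the set of pairs of homothety classes of hermitian metrics on $W$ and $W'$ onto the set of geodesics joining $z_W$ and $z_{W'}$, up to reparametrization. -/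

import Mathlib

open scoped NNReal ENNReal Matrix ComplexConjugate Topology

namespace SLSym

noncomputable section

/-! ### The symmetric space `Z = SL(n, ℂ) / SU(n)` and its Riemannian distance -/

/-- The group `SL(n, ℂ)`. -/
abbrev SLn (n : ℕ) : Type := Matrix.SpecialLinearGroup (Fin n) ℂ

/-- The maximal compact subgroup `SU(n)` of `SL(n, ℂ)`. -/
def SUn (n : ℕ) : Subgroup (SLn n) where
  carrier := {g | (g : Matrix (Fin n) (Fin n) ℂ) ∈ Matrix.unitaryGroup (Fin n) ℂ}
  mul_mem' {a b} ha hb := by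
    simp only [Set.mem_ofPred_eq, Matrix.SpecialLinearGroup.coe_mul] at *
    exact mul_mem ha hb
  one_mem' := by
    simp only [Set.mem_ofPred_eq, Matrix.SpecialLinearGroup.coe_one]
    exact one_mem _
  inv_mem' {a} ha := by
    simp only [Set.mem_ofPred_eq] at *
    have h1 : star (a : Matrix (Fin n) (Fin n) ℂ) * (a : Matrix (Fin n) (Fin n) ℂ) = 1 :=
      (Matrix.mem_unitaryGroup_iff').1 ha
    have h2 : (a : Matrix (Fin n) (Fin n) ℂ) * ((a⁻¹ : SLn n) : Matrix (Fin n) (Fin n) ℂ) = 1 := by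
      rw [← Matrix.SpecialLinearGroup.coe_mul, mul_inv_cancel, Matrix.SpecialLinearGroup.coe_one]
    have h3 : ((a⁻¹ : SLn n) : Matrix (Fin n) (Fin n) ℂ)
        = star (a : Matrix (Fin n) (Fin n) ℂ) := (left_inv_eq_right_inv h1 h2).symm
    rw [h3]
    exact Unitary.star_mem ha

/-- The symmetric space `Z = SL(n, ℂ) / SU(n)`, with the left action of `SL(n, ℂ)`. -/
abbrev ZSpace (n : ℕ) : Type := SLn n ⧸ SUn n

/-- The projection `τ : SL(n, ℂ) → Z`. -/
def tau {n : ℕ} (g : SLn n) : ZSpace n := (g : SLn n ⧸ SUn n)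

/-- The base point `u = τ 1` of `Z`. -/
def basePoint (n : ℕ) : ZSpace n := tau 1

/-- The Killing form `B(X, Y) = 4 n Re Tr (X Y)` of `sl(n, ℂ)` regarded as a real Lie algebra. -/
def killingB {n : ℕ} (X Y : Matrix (Fin n) (Fin n) ℂ) : ℝ := 4 * (n : ℝ) * (X * Y).trace.re

/-- The projection of `sl(n, ℂ) = 𝔭 ⊕ 𝔨` to its hermitian part `𝔭`, i.e. to `T_u Z`. -/
def pPart {n : ℕ} (X : Matrix (Fin n) (Fin n) ℂ) : Matrix (Fin n) (Fin n) ℂ :=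
  (1 / 2 : ℂ) • (X + Xᴴ)

/-- A curve of class `C¹` in `SL(n, ℂ)`. -/
def IsC1Curve {n : ℕ} (g : ℝ → SLn n) : Prop :=
  ∀ i j : Fin n, ContDiff ℝ 1 (fun t : ℝ => (g t : Matrix (Fin n) (Fin n) ℂ) i j)

/-- The velocity (entrywise derivative) of a curve in `SL(n, ℂ)`. -/
def velocity {n : ℕ} (g : ℝ → SLn n) (t : ℝ) : Matrix (Fin n) (Fin n) ℂ :=
  Matrix.of fun i j => deriv (fun s : ℝ => (g s : Matrix (Fin n) (Fin n) ℂ) i j) t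

/-- The speed at time `t` of the curve `τ ∘ g` in `Z` for the `SL(n, ℂ)`-invariant Riemannian
metric on `Z` which on `T_u Z = 𝔭` is the Killing form: translating by `g(t)⁻¹`, the tangent
vector of `τ ∘ g` becomes the `𝔭`-part of `g(t)⁻¹ g'(t)`. -/
def speed {n : ℕ} (g : ℝ → SLn n) (t : ℝ) : ℝ :=
  let X := pPart (((g t)⁻¹ : SLn n) * velocity g t : Matrix (Fin n) (Fin n) ℂ)
  Real.sqrt (killingB X X)

/-- The Riemannian length of the curve `τ ∘ g`, `0 ≤ t ≤ 1`, in `Z`. -/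
def curveLength {n : ℕ} (g : ℝ → SLn n) : ℝ≥0∞ :=
  ∫⁻ t in Set.Icc (0 : ℝ) 1, ENNReal.ofReal (speed g t)

/-- `HasCurve z w L`: there is a piecewise `C¹` curve of length `L` from `z` to `w` in `Z`.
(Every `C¹` curve `[0, 1] → Z` lifts to a `C¹` curve in `SL(n, ℂ)`.) -/
inductive HasCurve {n : ℕ} : ZSpace n → ZSpace n → ℝ≥0∞ → Prop
  | c1 (g : ℝ → SLn n) (hg : IsC1Curve g) : HasCurve (tau (g 0)) (tau (g 1)) (curveLength g)
  | concat {x y z : ZSpace n} {L M : ℝ≥0∞} (h₁ : HasCurve x y L) (h₂ : HasCurve y z M) :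
      HasCurve x z (L + M)

/-- The Riemannian distance on `Z`: the infimum of the lengths of piecewise `C¹` curves. -/
def riemDist {n : ℕ} (z w : ZSpace n) : ℝ≥0∞ := ⨅ (L : ℝ≥0∞) (_ : HasCurve z w L), L

theorem riemDist_le {n : ℕ} {z w : ZSpace n} {L : ℝ≥0∞} (h : HasCurve z w L) :
    riemDist z w ≤ L := iInf₂_le L h

theorem riemDist_triangle {n : ℕ} (x y z : ZSpace n) :
    riemDist x z ≤ riemDist x y + riemDist y z := by
  refine ENNReal.le_of_forall_pos_le_add ?_
  intro ε hε hlt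
  have hε2 : (ε / 2 : ℝ≥0∞) ≠ 0 := by
    simpa using hε.ne'
  have h1 : riemDist x y < ⊤ := lt_of_le_of_lt le_self_add hlt
  have h2 : riemDist y z < ⊤ := lt_of_le_of_lt le_add_self hlt
  have k1 : riemDist x y < riemDist x y + ε / 2 := ENNReal.lt_add_right h1.ne hε2
  have k2 : riemDist y z < riemDist y z + ε / 2 := ENNReal.lt_add_right h2.ne hε2
  have hlt' : ∀ {a b : ZSpace n} {N : ℝ≥0∞}, riemDist a b < N → ∃ L, ∃ _ : HasCurve a b L, L < N :=
    fun h => by simpa only [riemDist, iInf_lt_iff] using h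
  obtain ⟨L, hL, hL'⟩ := hlt' k1
  obtain ⟨M, hM, hM'⟩ := hlt' k2
  calc riemDist x z ≤ L + M := riemDist_le (HasCurve.concat hL hM)
    _ ≤ (riemDist x y + ε / 2) + (riemDist y z + ε / 2) := add_le_add hL'.le hM'.le
    _ = riemDist x y + riemDist y z + (ε / 2 + ε / 2) := by ring
    _ = riemDist x y + riemDist y z + ε := by rw [ENNReal.add_halves]

theorem riemDist_self {n : ℕ} (z : ZSpace n) : riemDist z z = 0 := by
  obtain ⟨g, rfl⟩ := QuotientGroup.mk_surjective z
  have h := HasCurve.c1 (fun _ : ℝ => g) (fun i j => contDiff_const)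
  have hL : curveLength (fun _ : ℝ => g) = 0 := by
    have hv : ∀ t, velocity (fun _ : ℝ => g) t = 0 := by
      intro t; ext i j; simp [velocity]
    simp [curveLength, speed, hv, pPart, killingB]
  rw [hL] at h
  exact le_antisymm (riemDist_le h) bot_le

theorem HasCurve.symm {n : ℕ} {z w : ZSpace n} {L : ℝ≥0∞} (h : HasCurve z w L) :
    HasCurve w z L := by
  induction h with
  | c1 g hg =>
    have hC : IsC1Curve (fun t : ℝ => g (1 - t)) := fun i j =>
      (hg i j).comp (contDiff_const.sub contDiff_id)
    have hv : ∀ t, velocity (fun t : ℝ => g (1 - t)) t = - velocity g (1 - t) := by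
      intro t
      ext i j
      simp only [velocity, Matrix.of_apply, Matrix.neg_apply]
      exact deriv_comp_const_sub (f := fun s : ℝ => (g s : Matrix (Fin n) (Fin n) ℂ) i j) 1 t
    have hs : ∀ t, speed (fun t : ℝ => g (1 - t)) t = speed g (1 - t) := by
      intro t
      simp only [speed, hv]
      have : ∀ Y : Matrix (Fin n) (Fin n) ℂ, pPart (-Y) = - pPart Y := by
        intro Y; simp [pPart, add_comm]
      rw [mul_neg, this]
      simp [killingB]
    have hL : curveLength (fun t : ℝ => g (1 - t)) = curveLength g := by
      have hmp : MeasureTheory.MeasurePreserving (fun t : ℝ => 1 - t)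
          MeasureTheory.volume MeasureTheory.volume :=
        MeasureTheory.Measure.measurePreserving_sub_left MeasureTheory.volume (1 : ℝ)
      have hemb : MeasurableEmbedding (fun t : ℝ => 1 - t) :=
        (Homeomorph.subLeft (1 : ℝ)).measurableEmbedding
      have := hmp.setLIntegral_comp_preimage_emb hemb
        (fun t => ENNReal.ofReal (speed g t)) (Set.Icc 0 1)
      simp only [curveLength, hs]
      rw [← this]
      congr 2
      ext t
      simp only [Set.mem_Icc, Set.mem_preimage]
      constructor <;> rintro ⟨h1, h2⟩ <;> constructor <;> linarith
    have := HasCurve.c1 _ hC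
    rw [hL] at this
    simpa using this
  | concat _ _ h1 h2 =>
    rw [add_comm]
    exact HasCurve.concat h2 h1

theorem riemDist_comm {n : ℕ} (z w : ZSpace n) : riemDist z w = riemDist w z :=
  le_antisymm (le_iInf₂ fun _ h => riemDist_le h.symm) (le_iInf₂ fun _ h => riemDist_le h.symm)

theorem HasCurve.smul {n : ℕ} (a : SLn n) {z w : ZSpace n} {L : ℝ≥0∞} (h : HasCurve z w L) :
    HasCurve (a • z) (a • w) L := by
  induction h with
  | c1 g hg =>
    have hC : IsC1Curve (fun t : ℝ => a * g t) := by
      intro i j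
      simp only [Matrix.SpecialLinearGroup.coe_mul, Matrix.mul_apply]
      exact ContDiff.sum fun k _ => contDiff_const.mul (hg k j)
    have hv : ∀ t, velocity (fun t : ℝ => a * g t) t
        = (a : Matrix (Fin n) (Fin n) ℂ) * velocity g t := by
      intro t
      ext i j
      simp only [velocity, Matrix.of_apply, Matrix.SpecialLinearGroup.coe_mul, Matrix.mul_apply]
      have hd : ∀ k, DifferentiableAt ℝ
          (fun s : ℝ => (g s : Matrix (Fin n) (Fin n) ℂ) k j) t := fun k =>
        ((hg k j).differentiable one_ne_zero) t
      rw [deriv_fun_sum fun k _ => (hd k).const_mul _]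
      exact Finset.sum_congr rfl fun k _ => deriv_const_mul _ (hd k)
    have hL : curveLength (fun t : ℝ => a * g t) = curveLength g := by
      have hs : ∀ t, speed (fun t : ℝ => a * g t) t = speed g t := by
        intro t
        have : (((a * g t)⁻¹ : SLn n) : Matrix (Fin n) (Fin n) ℂ) * (a : Matrix (Fin n) (Fin n) ℂ)
            = (((g t)⁻¹ : SLn n) : Matrix (Fin n) (Fin n) ℂ) := by
          rw [← Matrix.SpecialLinearGroup.coe_mul, mul_inv_rev, inv_mul_cancel_right]
        simp only [speed, hv]
        rw [← mul_assoc, this]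
      simp only [curveLength, hs]
    have := HasCurve.c1 _ hC
    rw [hL] at this
    exact this
  | concat _ _ h1 h2 => exact HasCurve.concat h1 h2

theorem riemDist_smul {n : ℕ} (a : SLn n) (z w : ZSpace n) :
    riemDist (a • z) (a • w) = riemDist z w := by
  refine le_antisymm (le_iInf₂ fun _ h => riemDist_le (h.smul a)) (le_iInf₂ fun _ h => ?_)
  have := h.smul a⁻¹
  simp only [inv_smul_smul] at this
  exact riemDist_le this

/-! ### Geodesics, rays and the boundary at infinity -/

/-- A unit speed geodesic in `Z`, defined on `T = ℝ` or on `T = ℝ≥0`: a curve which locally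
realizes the Riemannian distance and is parametrized by arc length. -/
def IsUnitSpeedGeodesic {n : ℕ} {T : Type} [PseudoEMetricSpace T] (γ : T → ZSpace n) : Prop :=
  ∀ t₀ : T, ∃ U ∈ 𝓝 t₀, ∀ s ∈ U, ∀ t ∈ U, riemDist (γ s) (γ t) = edist s t

/-- Rays in `Z`: unit speed half-geodesics. -/
def Ray (n : ℕ) : Type := {γ : ℝ≥0 → ZSpace n // IsUnitSpeedGeodesic γ}

/-- Two rays are asymptotic if their distance is bounded. -/
def Asymptotic {n : ℕ} (γ₁ γ₂ : Ray n) : Prop :=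
  ∃ C : ℝ≥0, ∀ t : ℝ≥0, riemDist (γ₁.1 t) (γ₂.1 t) ≤ C

/-- Being asymptotic is an equivalence relation. -/
instance asymptoticSetoid (n : ℕ) : Setoid (Ray n) where
  r := Asymptotic
  iseqv :=
    { refl := fun γ => ⟨0, fun t => by simp [riemDist_self]⟩
      symm := fun ⟨C, h⟩ => ⟨C, fun t => by rw [riemDist_comm]; exact h t⟩
      trans := fun ⟨C, h⟩ ⟨D, k⟩ => ⟨C + D, fun t =>
        (riemDist_triangle _ _ _).trans (by push_cast; exact add_le_add (h t) (k t))⟩ }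

/-- The boundary `Z(∞)`: asymptote classes of rays. -/
def Boundary (n : ℕ) : Type := Quotient (asymptoticSetoid n)

instance (n : ℕ) : MulAction (SLn n) (Ray n) where
  smul a γ := ⟨fun t => a • γ.1 t, fun t₀ => by
    obtain ⟨U, hU, h⟩ := γ.2 t₀
    exact ⟨U, hU, fun s hs t ht => by rw [riemDist_smul]; exact h s hs t ht⟩⟩
  one_smul γ := Subtype.ext (funext fun t => one_smul (SLn n) (γ.1 t))
  mul_smul a b γ := Subtype.ext (funext fun t => mul_smul a b (γ.1 t))

/-- `SL(n, ℂ)` acts on `Z(∞)` through its isometric action on `Z`. -/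
instance (n : ℕ) : MulAction (SLn n) (Boundary n) where
  smul a := Quotient.map (fun γ => a • γ) (fun γ₁ γ₂ ⟨C, h⟩ => ⟨C, fun t => by
    change riemDist (a • γ₁.1 t) (a • γ₂.1 t) ≤ C
    rw [riemDist_smul]; exact h t⟩)
  one_smul c := by
    induction c using Quotient.inductionOn with
    | h γ => exact congrArg (Quotient.mk _) (one_smul (SLn n) γ)
  mul_smul a b c := by
    induction c using Quotient.inductionOn with
    | h γ => exact congrArg (Quotient.mk _) (mul_smul a b γ)

/-- `c` is the boundary point `z_W` attached to the non-trivial subspace `W` of `ℂⁿ`, i.e. the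
point of `Z(∞)` whose stabilizer in `SL(n, ℂ)` is the maximal parabolic subgroup stabilizing
`W`. -/
def IsBoundaryPointOf {n : ℕ} (c : Boundary n) (W : Submodule ℂ (Fin n → ℂ)) : Prop :=
  ∀ a : SLn n, a ∈ MulAction.stabilizer (SLn n) c ↔
    W.map (Matrix.toLin' (a : Matrix (Fin n) (Fin n) ℂ)) = W

/-- Complete unit speed geodesics `ℝ → Z`. -/
def Geodesic (n : ℕ) : Type := {γ : ℝ → ZSpace n // IsUnitSpeedGeodesic γ}

/-- The end point in `Z(∞)` of a geodesic for `t → ∞`. -/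
def Geodesic.endPos {n : ℕ} (γ : Geodesic n) : Boundary n :=
  Quotient.mk _ ⟨fun t : ℝ≥0 => γ.1 t, fun t₀ => by
    obtain ⟨U, hU, h⟩ := γ.2 t₀
    exact ⟨_, NNReal.continuous_coe.continuousAt.preimage_mem_nhds hU,
      fun s hs t ht => h _ hs _ ht⟩⟩

/-- The end point in `Z(∞)` of a geodesic for `t → -∞`, i.e. the class of `t ↦ γ(-t)`. -/
def Geodesic.endNeg {n : ℕ} (γ : Geodesic n) : Boundary n :=
  Quotient.mk _ ⟨fun t : ℝ≥0 => γ.1 (-t), fun t₀ => by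
    obtain ⟨U, hU, h⟩ := γ.2 (-t₀)
    have hc : Continuous (fun t : ℝ≥0 => -(t : ℝ)) := NNReal.continuous_coe.neg
    exact ⟨_, hc.continuousAt.preimage_mem_nhds hU,
      fun s hs t ht => (h _ hs _ ht).trans (edist_neg_neg (s : ℝ) (t : ℝ))⟩⟩

/-- The (unoriented) geodesic `γ` joins `z_W` and `z_{W'}`. -/
def Geodesic.Joins {n : ℕ} (γ : Geodesic n) (W W' : Submodule ℂ (Fin n → ℂ)) : Prop :=
  (IsBoundaryPointOf γ.endPos W ∧ IsBoundaryPointOf γ.endNeg W') ∨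
    (IsBoundaryPointOf γ.endPos W' ∧ IsBoundaryPointOf γ.endNeg W)

/-- Geodesics joining `z_W` and `z_{W'}`, up to reparametrization `t ↦ a t + b` with `a ≠ 0`. -/
instance reparamSetoid {n : ℕ} (W W' : Submodule ℂ (Fin n → ℂ)) :
    Setoid {γ : Geodesic n // γ.Joins W W'} where
  r γ₁ γ₂ := ∃ a b : ℝ, a ≠ 0 ∧ ∀ t : ℝ, γ₂.1.1 t = γ₁.1.1 (a * t + b)
  iseqv :=
    { refl := fun γ => ⟨1, 0, one_ne_zero, fun t => by simp⟩
      symm := fun ⟨a, b, ha, h⟩ => ⟨a⁻¹, -(a⁻¹ * b), inv_ne_zero ha, fun t => by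
        rw [h, show a * (a⁻¹ * t + -(a⁻¹ * b)) + b = t by field_simp; ring]⟩
      trans := fun ⟨a, b, ha, h⟩ ⟨c, d, hc, k⟩ => ⟨a * c, a * d + b, mul_ne_zero ha hc, fun t => by
        rw [k, h, show a * (c * t + d) + b = a * c * t + (a * d + b) by ring]⟩ }

/-- The set of geodesics joining `z_W` and `z_{W'}` up to reparametrization. -/
def JoiningGeodesics {n : ℕ} (W W' : Submodule ℂ (Fin n → ℂ)) : Type :=
  Quotient (reparamSetoid W W')

/-! ### Hermitian metrics -/

/-- Hermitian metrics, i.e. positive definite hermitian forms, on a complex vector space. -/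
structure HermitianMetric (V : Type) [AddCommGroup V] [Module ℂ V] where
  form : V →ₗ⋆[ℂ] V →ₗ[ℂ] ℂ
  conj_symm : ∀ x y, conj (form x y) = form y x
  pos : ∀ x, x ≠ 0 → 0 < (form x x).re

/-- Homothety of hermitian metrics: one is a positive real multiple of the other. -/
instance homothetySetoid (V : Type) [AddCommGroup V] [Module ℂ V] :
    Setoid (HermitianMetric V) where
  r h₁ h₂ := ∃ c : ℝ, 0 < c ∧ ∀ x y, h₂.form x y = (c : ℂ) * h₁.form x y
  iseqv :=
    { refl := fun h => ⟨1, one_pos, fun x y => by simp⟩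
      symm := fun ⟨c, hc, h⟩ => ⟨c⁻¹, inv_pos.2 hc, fun x y => by
        have hc' : (c : ℂ) ≠ 0 := by exact_mod_cast hc.ne'
        rw [h]; push_cast; field_simp⟩
      trans := fun ⟨c, hc, h⟩ ⟨d, hd, k⟩ => ⟨d * c, mul_pos hd hc, fun x y => by
        rw [k, h]; push_cast; ring⟩ }

/-- Homothety classes `{h}` of hermitian metrics. -/
def MetricClass (V : Type) [AddCommGroup V] [Module ℂ V] : Type :=
  Quotient (homothetySetoid V)

/-- The family `v` of vectors of `ℂⁿ` is an orthonormal basis of `W` for some metric in the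
homothety class `c`. -/
def IsOrthonormalBasisOf {n : ℕ} {ι : Type} [DecidableEq ι] {W : Submodule ℂ (Fin n → ℂ)}
    (c : MetricClass W) (v : ι → Fin n → ℂ) : Prop :=
  ∃ h : HermitianMetric W, Quotient.mk (homothetySetoid W) h = c ∧
    ∃ b : Module.Basis ι ℂ W, (∀ i, (b i : Fin n → ℂ) = v i) ∧
      ∀ i j, h.form (b i) (b j) = if i = j then 1 else 0

/-- With `r = dim W`: `g e₁, …, g e_r` is an orthonormal basis of `W` for a metric in `c`, and
`g e_{r+1}, …, g e_n` is an orthonormal basis of `W'` for a metric in `c'`. -/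
def IsAdapted {n : ℕ} (r : ℕ) {W W' : Submodule ℂ (Fin n → ℂ)} (c : MetricClass W) (c' : MetricClass W')
    (g : SLn n) : Prop :=
  IsOrthonormalBasisOf c (fun i : {i : Fin n // (i : ℕ) < r} =>
      (g : Matrix (Fin n) (Fin n) ℂ) *ᵥ Pi.single i.1 1) ∧
    IsOrthonormalBasisOf c' (fun i : {i : Fin n // r ≤ (i : ℕ)} =>
      (g : Matrix (Fin n) (Fin n) ℂ) *ᵥ Pi.single i.1 1)

/-! ### The curves `g exp(t diag(ρ, …, ρ, σ, …, σ)) u` -/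

/-- `ρ = √((n - r) / (4 r n²))`. -/
def rho (n r : ℕ) : ℝ := Real.sqrt (((n : ℝ) - r) / (4 * r * (n : ℝ) ^ 2))

/-- `σ = -(r / (n - r)) ρ`. -/
def sigma (n r : ℕ) : ℝ := -((r : ℝ) / ((n : ℝ) - r)) * rho n r

/-- The diagonal matrix `diag(ρ, …, ρ, σ, …, σ)`, with `r` entries `ρ`. -/
def diagRhoSigma (n r : ℕ) : Matrix (Fin n) (Fin n) ℂ :=
  Matrix.diagonal fun i : Fin n => if (i : ℕ) < r then (rho n r : ℂ) else (sigma n r : ℂ)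

theorem trace_diagRhoSigma {n r : ℕ} (hr : r < n) : (diagRhoSigma n r).trace = 0 := by
  have h1 : (Finset.univ.filter fun i : Fin n => (i : ℕ) < r).card = r := by
    rw [Fin.card_filter_val_lt]; omega
  have h2 : (Finset.univ.filter fun i : Fin n => ¬ (i : ℕ) < r).card = n - r := by
    have := Finset.card_filter_add_card_filter_not (s := (Finset.univ : Finset (Fin n)))
      (fun i : Fin n => (i : ℕ) < r)
    rw [h1, Finset.card_univ, Fintype.card_fin] at this
    omega
  have hne : ((n : ℂ) - r) ≠ 0 := by
    rw [sub_ne_zero]; exact_mod_cast hr.ne'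
  rw [diagRhoSigma, Matrix.trace_diagonal, Finset.sum_ite, Finset.sum_const, Finset.sum_const,
    h1, h2, nsmul_eq_mul, nsmul_eq_mul, Nat.cast_sub hr.le]
  simp only [sigma]
  push_cast
  field_simp
  ring

/-- The element `exp(t diag(ρ, …, ρ, σ, …, σ))` of `SL(n, ℂ)`. -/
def expDiag (n r : ℕ) (hr : r < n) (t : ℝ) : SLn n :=
  ⟨NormedSpace.exp ((t : ℂ) • diagRhoSigma n r), by
    have h0 : ∑ i : Fin n, (if (i : ℕ) < r then (rho n r : ℂ) else (sigma n r : ℂ)) = 0 := by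
      have := trace_diagRhoSigma hr
      rwa [diagRhoSigma, Matrix.trace_diagonal] at this
    rw [diagRhoSigma, ← Matrix.diagonal_smul, Matrix.exp_diagonal, Matrix.det_diagonal]
    simp only [Pi.coe_exp, Pi.smul_apply, smul_eq_mul, ← Complex.exp_eq_exp_ℂ]
    rw [← Complex.exp_sum, ← Finset.mul_sum, h0, mul_zero, Complex.exp_zero]⟩

/-- The curve `t ↦ g exp(t diag(ρ, …, ρ, σ, …, σ)) u` in `Z`. -/
def stdCurve {n r : ℕ} (hr : r < n) (g : SLn n) (t : ℝ) : ZSpace n :=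
  (g * expDiag n r hr t) • basePoint n

end

end SLSym

namespace SLSym

noncomputable section

open scoped ComplexOrder

/-! ### Principal minors -/

/-! A point `g u` of Z is the positive definite matrix `g gᴴ`. The first task is to find all
geodesics, which are defined only through the length metric. The tool is the Iwasawa projection,
whose coordinates are logarithms of ratios of consecutive leading principal minors of `g gᴴ`. In a
suitable triangular frame its derivative is the diagonal of a hermitian matrix whose full Frobenius
norm gives the speed, so it does not increase distances (`enorm_iwasawa_sub_le`). On the real
diagonal matrices it is linear and preserves length, so the flat is isometric to a Euclidean space
(`riemDist_diagExp`). Equality forces the off-diagonal entries to vanish, which makes segments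
unique (`eq_tau_mul_diagExp_of_riemDist_eq`). Analyticity then glues the local pieces: every
complete geodesic is `t ↦ g exp(tΛ) u` (`Geodesic.exists_eq`).

An element `a` fixes the end of this geodesic at `+∞` iff `exp(-tΛ) g⁻¹ a g exp(tΛ)` stays bounded
for `t ≥ 0`. The entry `(i, j)` is scaled by `exp(t(Λⱼ - Λᵢ))`, so the condition is that entries
with `Λᵢ < Λⱼ` vanish. Such a group is the stabilizer of a flag. If it is the stabilizer of W, the
flag consists of W alone, because transvections show that the stabilizer of W preserves no other
proper nonzero subspace (`eq_of_invariant`). Hence Λ has two values. Trace zero, unit speed and `dim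
W = r` force these to be ρ and σ, and W, W' are spanned by the two groups of columns of `g`.

Along such a geodesic `g gᴴ` evolves as `exp(2tρ) P + exp(2tσ) P'`, where `P` and `P'` (`frameGram`)
are the inverses of the hermitian metrics on W and W' for which the columns are orthonormal.
Rescaling `P` and `P'` while keeping determinant one amounts to a shift of `t` (`exists_shift`).
Conversely, since `W ∩ W' = 0`, one point of the curve determines `P` and `P'` up to positive
factors (`exists_frameGram_eq_smul`). So geodesics up to reparametrization correspond to pairs of
homothety classes. -/

theorem hasDerivAt_det_of_eq_one {ι : Type*} [Fintype ι] [DecidableEq ι]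
    {A : ℝ → Matrix ι ι ℂ} {A' : Matrix ι ι ℂ} {t : ℝ}
    (hA : ∀ i j, HasDerivAt (fun s => A s i j) (A' i j) t) (h1 : A t = 1) :
    HasDerivAt (fun s => (A s).det) A'.trace t := by
  simp only [Matrix.det_apply]
  have key : ∀ σ : Equiv.Perm ι, HasDerivAt (fun s => Equiv.Perm.sign σ • ∏ i, A s (σ i) i)
      (if σ = 1 then A'.trace else 0) t := by
    intro σ
    have h := (HasDerivAt.fun_finsetProd (u := Finset.univ)
      (f := fun i s => A s (σ i) i) (f' := fun i => A' (σ i) i) (x := t)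
      fun i _ => hA (σ i) i).const_smul (Equiv.Perm.sign σ)
    convert! h using 1
    split_ifs with hσ
    · subst hσ
      simp only [Equiv.Perm.sign_one, one_smul, Equiv.Perm.coe_one, id_eq, h1, Matrix.trace,
        Matrix.diag_apply]
      refine Finset.sum_congr rfl fun i _ => ?_
      simp
    · symm
      rw [Finset.sum_eq_zero, smul_zero]
      intro i _
      -- A nontrivial permutation moves at least two indices, namely `j` and `σ j`. After one factor
      -- is differentiated, an off-diagonal zero of the identity matrix is still left in the
      -- product.
      obtain ⟨j, hj, hji⟩ : ∃ j, σ j ≠ j ∧ j ≠ i := by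
        by_contra! hcon
        apply hσ
        ext j
        by_contra hj
        have hji := hcon j hj
        have h2 : σ (σ j) ≠ σ j := fun h => hj (σ.injective h)
        exact hj ((hcon _ h2).trans hji.symm)
      rw [Finset.prod_eq_zero (Finset.mem_erase.2 ⟨hji, Finset.mem_univ j⟩), zero_smul]
      rw [h1, Matrix.one_apply_ne hj]
  convert! HasDerivAt.fun_sum (u := Finset.univ) fun σ _ => key σ using 1
  simp

/-- The principal minor of `A` on the rows and columns satisfying `p`. -/
def minor {n : ℕ} (p : Fin n → Prop) [DecidablePred p] (A : Matrix (Fin n) (Fin n) ℂ) : ℂ :=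
  (A.toBlock p p).det

theorem minor_pos {n : ℕ} (p : Fin n → Prop) [DecidablePred p] {A : Matrix (Fin n) (Fin n) ℂ}
    (hA : A.PosDef) : 0 < minor p A :=
  (hA.submatrix Subtype.val_injective).det_pos

/-- Rows of `l` in `p` have no entries outside `p`, so the `p`-block of the product involves only
`p`-blocks. For initial segments `p` this makes the logarithms of minors change by constants under
lower triangular congruence. -/
theorem minor_lower_conj {n : ℕ} (p : Fin n → Prop) [DecidablePred p]
    {l : Matrix (Fin n) (Fin n) ℂ} (hl : ∀ i j, p i → ¬ p j → l i j = 0)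
    (A : Matrix (Fin n) (Fin n) ℂ) :
    minor p (l * A * lᴴ) = ((Complex.normSq (minor p l) : ℝ) : ℂ) * minor p A := by
  have h0 : (l.toBlock p fun i => ¬ p i) = 0 := by
    ext i j
    exact hl _ _ i.2 j.2
  have h0' : (lᴴ.toBlock (fun i => ¬ p i) p) = 0 := by
    ext i j
    simp [hl _ _ j.2 i.2]
  have h1 : lᴴ.toBlock p p = (l.toBlock p p)ᴴ := rfl
  rw [minor, Matrix.toBlock_mul_eq_add p p p, Matrix.toBlock_mul_eq_add p p p, h0, h0', h1]
  simp only [Matrix.zero_mul, Matrix.mul_zero, add_zero, Matrix.det_mul, Matrix.det_conjTranspose]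
  rw [Complex.normSq_eq_conj_mul_self, minor, minor]
  simp only [RCLike.star_def]
  ring

theorem posDef_mul_conjTranspose {n : ℕ} (g : SLn n) :
    ((g : Matrix (Fin n) (Fin n) ℂ) * (g : Matrix (Fin n) (Fin n) ℂ)ᴴ).PosDef := by
  have hu : IsUnit (g : Matrix (Fin n) (Fin n) ℂ) := by
    rw [Matrix.isUnit_iff_isUnit_det, g.det_coe]; exact isUnit_one
  exact Matrix.PosDef.mul_conjTranspose_self _ (Matrix.vecMul_injective_of_isUnit hu)

/-- A positive definite matrix becomes the identity under a lower triangular congruence. -/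
theorem exists_lower_conj_eq_one {n : ℕ} {A : Matrix (Fin n) (Fin n) ℂ} (hA : A.PosDef) :
    ∃ l : Matrix (Fin n) (Fin n) ℂ, (∀ i j, i < j → l i j = 0) ∧ l * A * lᴴ = 1 := by
  have hD := LDL.diag_eq_lowerInv_conj hA
  have hpos : (LDL.diag hA).PosDef := by
    rw [hD]
    exact hA.mul_mul_conjTranspose_same
      (Matrix.vecMul_injective_of_isUnit (isUnit_of_invertible (LDL.lowerInv hA)))
  have hd : ∀ i, 0 < LDL.diagEntries hA i := Matrix.posDef_diagonal_iff.1 hpos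
  set d := LDL.diagEntries hA
  have hre : ∀ i, ((d i).re : ℂ) = d i ∧ 0 < (d i).re := fun i => by
    obtain ⟨h1, h2⟩ := Complex.pos_iff.1 (hd i)
    exact ⟨Complex.ext (by simp) (by simp [← h2]), h1⟩
  -- Inverse square roots of the LDL pivots normalize the diagonal factor to the identity.
  let e : Fin n → ℂ := fun i => ((Real.sqrt (d i).re)⁻¹ : ℝ)
  refine ⟨Matrix.diagonal e * LDL.lowerInv hA, fun i j hij => ?_, ?_⟩
  · rw [Matrix.diagonal_mul, LDL.lowerInv_triangular hA hij, mul_zero]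
  · have : Matrix.diagonal e * LDL.lowerInv hA * A * (Matrix.diagonal e * LDL.lowerInv hA)ᴴ
        = Matrix.diagonal e * LDL.diag hA * (Matrix.diagonal e)ᴴ := by
      rw [hD, Matrix.conjTranspose_mul]; simp only [Matrix.mul_assoc]
    rw [this, LDL.diag, Matrix.diagonal_conjTranspose, Matrix.diagonal_mul_diagonal,
      Matrix.diagonal_mul_diagonal, ← Matrix.diagonal_one]
    congr 1
    ext i
    have hs : Real.sqrt (d i).re ≠ 0 := (Real.sqrt_pos.2 (hre i).2).ne'
    have : (d i) = ((Real.sqrt (d i).re * Real.sqrt (d i).re : ℝ) : ℂ) := by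
      rw [Real.mul_self_sqrt (hre i).2.le, (hre i).1]
    change e i * d i * star (e i) = 1
    rw [this]
    simp only [e, RCLike.star_def, Complex.conj_ofReal]
    rw [← Complex.ofReal_mul, ← Complex.ofReal_mul, Complex.ofReal_eq_one]
    field_simp

/-- Entrywise derivative of a curve of matrices. -/
def HasMatDerivAt {n : ℕ} (A : ℝ → Matrix (Fin n) (Fin n) ℂ) (A' : Matrix (Fin n) (Fin n) ℂ)
    (t : ℝ) : Prop :=
  ∀ i j, HasDerivAt (fun s => A s i j) (A' i j) t

theorem HasMatDerivAt.mul {n : ℕ} {A B : ℝ → Matrix (Fin n) (Fin n) ℂ}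
    {A' B' : Matrix (Fin n) (Fin n) ℂ} {t : ℝ} (hA : HasMatDerivAt A A' t)
    (hB : HasMatDerivAt B B' t) :
    HasMatDerivAt (fun s => A s * B s) (A' * B t + A t * B') t := by
  intro i j
  simp only [Matrix.mul_apply, Matrix.add_apply]
  rw [← Finset.sum_add_distrib]
  exact HasDerivAt.fun_sum fun k _ => (hA i k).mul (hB k j)

theorem hasMatDerivAt_const {n : ℕ} (A : Matrix (Fin n) (Fin n) ℂ) (t : ℝ) :
    HasMatDerivAt (fun _ => A) 0 t := fun i j => hasDerivAt_const t (A i j)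

theorem HasMatDerivAt.conjTranspose {n : ℕ} {A : ℝ → Matrix (Fin n) (Fin n) ℂ}
    {A' : Matrix (Fin n) (Fin n) ℂ} {t : ℝ} (hA : HasMatDerivAt A A' t) :
    HasMatDerivAt (fun s => (A s)ᴴ) A'ᴴ t := fun i j => (hA j i).star

theorem IsC1Curve.hasMatDerivAt {n : ℕ} {g : ℝ → SLn n} (hg : IsC1Curve g) (t : ℝ) :
    HasMatDerivAt (fun s => (g s : Matrix (Fin n) (Fin n) ℂ)) (velocity g t) t := fun i j =>
  (((hg i j).differentiable one_ne_zero) t).hasDerivAt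

/-! ### The Iwasawa projection -/

/-- The (suitably scaled) logarithm of the `A`-part of `g` in the decomposition `G = N A K`,
computed from the leading principal minors of `g gᴴ`. -/
def iwasawa {n : ℕ} (g : SLn n) : EuclideanSpace ℝ (Fin n) :=
  WithLp.toLp 2 fun k => Real.sqrt n *
    (Real.log (minor (· ≤ k) ((g : Matrix (Fin n) (Fin n) ℂ) * (g : Matrix (Fin n) (Fin n) ℂ)ᴴ)).re -
      Real.log (minor (· < k) ((g : Matrix (Fin n) (Fin n) ℂ) * (g : Matrix (Fin n) (Fin n) ℂ)ᴴ)).re)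

theorem minor_re_pos {n : ℕ} (p : Fin n → Prop) [DecidablePred p] (g : SLn n) :
    0 < (minor p ((g : Matrix (Fin n) (Fin n) ℂ) * (g : Matrix (Fin n) (Fin n) ℂ)ᴴ)).re :=
  (Complex.pos_iff.1 (minor_pos p (posDef_mul_conjTranspose g))).1

/-- Congruence by the fixed matrix `l` only adds a constant to the logarithm of the minor, and it
moves the curve so that it passes through the identity at time `t`. There both the determinant and
the logarithm have their simplest derivative: the trace of the block. -/
theorem hasDerivAt_log_minor {n : ℕ} (p : Fin n → Prop) [DecidablePred p] {g : ℝ → SLn n}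
    {G' l : Matrix (Fin n) (Fin n) ℂ} {t : ℝ}
    (hg : HasMatDerivAt (fun s => (g s : Matrix (Fin n) (Fin n) ℂ)) G' t)
    (hl : ∀ i j, p i → ¬ p j → l i j = 0)
    (h1 : l * ((g t : Matrix (Fin n) (Fin n) ℂ) * (g t : Matrix (Fin n) (Fin n) ℂ)ᴴ) * lᴴ = 1) :
    HasDerivAt (fun s => Real.log
        (minor p ((g s : Matrix (Fin n) (Fin n) ℂ) * (g s : Matrix (Fin n) (Fin n) ℂ)ᴴ)).re)
      (∑ k : {k // p k}, ((l * (G' * (g t : Matrix (Fin n) (Fin n) ℂ)ᴴ +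
        (g t : Matrix (Fin n) (Fin n) ℂ) * G'ᴴ) * lᴴ) k k).re) t := by
  set P : ℝ → Matrix (Fin n) (Fin n) ℂ :=
    fun s => (g s : Matrix (Fin n) (Fin n) ℂ) * (g s : Matrix (Fin n) (Fin n) ℂ)ᴴ with hP
  have hP' := hg.mul hg.conjTranspose
  have hB : HasMatDerivAt (fun s => l * P s * lᴴ)
      (l * (G' * (g t : Matrix (Fin n) (Fin n) ℂ)ᴴ +
        (g t : Matrix (Fin n) (Fin n) ℂ) * G'ᴴ) * lᴴ) t := by
    convert! ((hasMatDerivAt_const l t).mul hP').mul (hasMatDerivAt_const lᴴ t) using 1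
    simp
  set B := l * (G' * (g t : Matrix (Fin n) (Fin n) ℂ)ᴴ +
        (g t : Matrix (Fin n) (Fin n) ℂ) * G'ᴴ) * lᴴ
  have hdet : HasDerivAt (fun s => minor p (l * P s * lᴴ)) (B.toBlock p p).trace t := by
    refine hasDerivAt_det_of_eq_one (fun i j => hB i j) ?_
    rw [h1, Matrix.toBlock_one_self]
  have hre : HasDerivAt (fun s => (minor p (l * P s * lᴴ)).re) (B.toBlock p p).trace.re t :=
    Complex.reCLM.hasFDerivAt.comp_hasDerivAt t hdet
  have hone : (minor p (l * P t * lᴴ)).re = 1 := by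
    rw [h1, minor, Matrix.toBlock_one_self, Matrix.det_one, Complex.one_re]
  set c := Complex.normSq (minor p l)
  have hc : ∀ s, (minor p (l * P s * lᴴ)).re = c * (minor p (P s)).re := fun s => by
    rw [minor_lower_conj p hl, Complex.re_ofReal_mul]
  have hc0 : c ≠ 0 := fun h => by
    have := hc t
    rw [hone, h, zero_mul] at this
    exact one_ne_zero this
  have hlog := (hre.log (by rw [hone]; exact one_ne_zero)).sub_const (Real.log c)
  rw [hone, div_one] at hlog
  convert! hlog using 1
  · ext s
    rw [hc, Real.log_mul hc0 (minor_re_pos p (g s)).ne']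
    ring
  · rw [Matrix.trace, Complex.re_sum]
    rfl

theorem sum_subtype_le_sub_sum_subtype_lt {n : ℕ} (f : Fin n → ℝ) (k : Fin n) :
    ∑ i : {i // i ≤ k}, f i - ∑ i : {i // i < k}, f i = f k := by
  have e1 := Finset.sum_subtype_eq_sum_filter (s := Finset.univ) f (p := fun i => i ≤ k)
  have e2 := Finset.sum_subtype_eq_sum_filter (s := Finset.univ) f (p := fun i => i < k)
  simp only [Finset.subtype_univ] at e1 e2
  rw [e1, e2, Finset.filter_ge_eq_Iic, Finset.filter_gt_eq_Iio,
    ← Finset.Iio_insert, Finset.sum_insert (by simp), add_sub_cancel_right]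

/-- The derivatives for `· ≤ k` and `· < k` are partial traces whose difference is the `k`-th
diagonal entry. -/
theorem hasDerivAt_iwasawa {n : ℕ} {g : ℝ → SLn n}
    {G' l : Matrix (Fin n) (Fin n) ℂ} {t : ℝ}
    (hg : HasMatDerivAt (fun s => (g s : Matrix (Fin n) (Fin n) ℂ)) G' t)
    (hl : ∀ i j, i < j → l i j = 0)
    (h1 : l * ((g t : Matrix (Fin n) (Fin n) ℂ) * (g t : Matrix (Fin n) (Fin n) ℂ)ᴴ) * lᴴ = 1) :
    HasDerivAt (fun s => iwasawa (g s))
      (WithLp.toLp 2 fun k => Real.sqrt n * ((l * (G' * (g t : Matrix (Fin n) (Fin n) ℂ)ᴴ +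
        (g t : Matrix (Fin n) (Fin n) ℂ) * G'ᴴ) * lᴴ) k k).re) t := by
  set B := l * (G' * (g t : Matrix (Fin n) (Fin n) ℂ)ᴴ +
        (g t : Matrix (Fin n) (Fin n) ℂ) * G'ᴴ) * lᴴ with hB
  have key : HasDerivAt (fun s => WithLp.ofLp (iwasawa (g s)))
      (fun k => Real.sqrt n * (B k k).re) t := by
    rw [hasDerivAt_pi]
    intro k
    have h2 := hasDerivAt_log_minor (· ≤ k) hg
      (fun i j hi hj => hl i j (lt_of_le_of_lt hi (not_le.1 hj))) h1
    have h3 := hasDerivAt_log_minor (· < k) hg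
      (fun i j hi hj => hl i j (lt_of_lt_of_le hi (not_lt.1 hj))) h1
    convert! (h2.sub h3).const_mul (Real.sqrt n) using 2
    rw [← hB, sum_subtype_le_sub_sum_subtype_lt fun i => (B i i).re]
  exact ((EuclideanSpace.equiv (Fin n) ℝ).symm.toContinuousLinearMap.hasFDerivAt).comp_hasDerivAt
    t key

theorem contDiff_iwasawa {n : ℕ} {g : ℝ → SLn n} (hg : IsC1Curve g) :
    ContDiff ℝ 1 (fun s => iwasawa (g s)) := by
  have hm : ∀ (p : Fin n → Prop) [DecidablePred p], ContDiff ℝ 1 (fun s => Real.log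
        (minor p ((g s : Matrix (Fin n) (Fin n) ℂ) * (g s : Matrix (Fin n) (Fin n) ℂ)ᴴ)).re) := by
    intro p _
    refine ContDiff.log ?_ fun s => (minor_re_pos p (g s)).ne'
    refine Complex.reCLM.contDiff.comp ?_
    simp only [minor, Matrix.det_apply]
    refine ContDiff.sum fun σ _ => ContDiff.const_smul _ (contDiff_prod fun i _ => ?_)
    simp only [Matrix.toBlock_apply, Matrix.mul_apply]
    exact ContDiff.sum fun k _ => (hg _ k).mul ((starL' ℝ (A := ℂ)).contDiff.comp (hg _ k))
  rw [contDiff_euclidean]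
  intro k
  exact contDiff_const.mul ((hm _).sub (hm _))

/-! ### Points of Z as positive definite matrices. -/

theorem mem_SUn_iff {n : ℕ} {k : SLn n} : k ∈ SUn n ↔
    (k : Matrix (Fin n) (Fin n) ℂ) * (k : Matrix (Fin n) (Fin n) ℂ)ᴴ = 1 :=
  Matrix.mem_unitaryGroup_iff

theorem mem_SUn_iff' {n : ℕ} {k : SLn n} : k ∈ SUn n ↔
    (k : Matrix (Fin n) (Fin n) ℂ)ᴴ * (k : Matrix (Fin n) (Fin n) ℂ) = 1 :=
  Matrix.mem_unitaryGroup_iff'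

theorem coe_mul_coe_inv {n : ℕ} (g : SLn n) :
    (g : Matrix (Fin n) (Fin n) ℂ) * ((g⁻¹ : SLn n) : Matrix (Fin n) (Fin n) ℂ) = 1 := by
  rw [← Matrix.SpecialLinearGroup.coe_mul, mul_inv_cancel, Matrix.SpecialLinearGroup.coe_one]

theorem coe_inv_mul_coe {n : ℕ} (g : SLn n) :
    ((g⁻¹ : SLn n) : Matrix (Fin n) (Fin n) ℂ) * (g : Matrix (Fin n) (Fin n) ℂ) = 1 := by
  rw [← Matrix.SpecialLinearGroup.coe_mul, inv_mul_cancel, Matrix.SpecialLinearGroup.coe_one]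

/-- This identifies Z with matrices `g gᴴ`, and later equalities of points are checked there. -/
theorem tau_eq_iff {n : ℕ} {g h : SLn n} : tau g = tau h ↔
    (g : Matrix (Fin n) (Fin n) ℂ) * (g : Matrix (Fin n) (Fin n) ℂ)ᴴ =
      (h : Matrix (Fin n) (Fin n) ℂ) * (h : Matrix (Fin n) (Fin n) ℂ)ᴴ := by
  have h1 := coe_inv_mul_coe g
  have h2 := coe_mul_coe_inv g
  have h1' := congrArg Matrix.conjTranspose h1
  have h2' := congrArg Matrix.conjTranspose h2
  rw [Matrix.conjTranspose_mul, Matrix.conjTranspose_one] at h1' h2'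
  rw [tau, tau, QuotientGroup.eq, mem_SUn_iff, Matrix.SpecialLinearGroup.coe_mul,
    Matrix.conjTranspose_mul]
  set G := (g : Matrix (Fin n) (Fin n) ℂ)
  set I := ((g⁻¹ : SLn n) : Matrix (Fin n) (Fin n) ℂ)
  set H := (h : Matrix (Fin n) (Fin n) ℂ)
  constructor
  · intro h
    calc G * Gᴴ = G * (I * H * (Hᴴ * Iᴴ)) * Gᴴ := by rw [h, Matrix.mul_one]
      _ = (G * I) * (H * Hᴴ) * (Iᴴ * Gᴴ) := by simp only [Matrix.mul_assoc]
      _ = H * Hᴴ := by rw [h2, h2', Matrix.one_mul, Matrix.mul_one]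
  · intro h
    calc I * H * (Hᴴ * Iᴴ) = I * (H * Hᴴ) * Iᴴ := by simp only [Matrix.mul_assoc]
      _ = (I * G) * (Gᴴ * Iᴴ) := by rw [← h]; simp only [Matrix.mul_assoc]
      _ = 1 := by rw [h1, h1', Matrix.one_mul]

theorem smul_tau {n : ℕ} (g h : SLn n) : g • tau h = tau (g * h) := rfl

theorem smul_basePoint {n : ℕ} (g : SLn n) : g • basePoint n = tau g := by
  rw [basePoint, smul_tau, mul_one]

theorem tau_mul_of_mem {n : ℕ} (g : SLn n) {k : SLn n} (hk : k ∈ SUn n) : tau (g * k) = tau g := by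
  rw [tau_eq_iff, Matrix.SpecialLinearGroup.coe_mul, Matrix.conjTranspose_mul]
  rw [mem_SUn_iff] at hk
  rw [Matrix.mul_assoc, ← Matrix.mul_assoc (k : Matrix (Fin n) (Fin n) ℂ), hk, Matrix.one_mul]

theorem exists_tau_eq {n : ℕ} (z : ZSpace n) : ∃ g : SLn n, tau g = z :=
  QuotientGroup.mk_surjective z

theorem iwasawa_eq_of_tau_eq {n : ℕ} {g h : SLn n} (hgh : tau g = tau h) :
    iwasawa g = iwasawa h := by
  rw [tau_eq_iff] at hgh
  simp only [iwasawa, hgh]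

/-! ### The Iwasawa projection does not increase distances -/

theorem trace_mul_self_re {n : ℕ} {B : Matrix (Fin n) (Fin n) ℂ} (hB : Bᴴ = B) :
    (B * B).trace.re = ∑ i, ∑ j, Complex.normSq (B i j) := by
  rw [Matrix.trace, Complex.re_sum]
  refine Finset.sum_congr rfl fun i _ => ?_
  rw [Matrix.diag_apply, Matrix.mul_apply, Complex.re_sum]
  refine Finset.sum_congr rfl fun j _ => ?_
  have : B j i = conj (B i j) := by
    conv_lhs => rw [← hB]
    rfl
  rw [this, Complex.mul_conj, Complex.ofReal_re]

theorem sum_sq_re_diag_le {n : ℕ} {B : Matrix (Fin n) (Fin n) ℂ} (hB : Bᴴ = B) :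
    ∑ k, (B k k).re ^ 2 ≤ (B * B).trace.re := by
  rw [trace_mul_self_re hB]
  refine Finset.sum_le_sum fun i _ => ?_
  refine le_trans ?_ (Finset.single_le_sum (f := fun j => Complex.normSq (B i j))
    (fun j _ => Complex.normSq_nonneg _) (Finset.mem_univ i))
  rw [Complex.normSq_apply]
  nlinarith [mul_self_nonneg (B i i).im]

/-- With `l` triangular and `q = l g` unitary, the 𝔭-part of `g⁻¹ g'` is conjugate under `q` to `B /
2`, while the projection has derivative `√n` times the diagonal of `B`. The inequality just drops
the off-diagonal entries. -/
theorem norm_deriv_iwasawa_le_speed {n : ℕ} {g : ℝ → SLn n} (hg : IsC1Curve g) (t : ℝ) :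
    ‖deriv (fun s => iwasawa (g s)) t‖ ≤ speed g t := by
  obtain ⟨l, hl, h1⟩ := exists_lower_conj_eq_one (posDef_mul_conjTranspose (g t))
  rw [(hasDerivAt_iwasawa (hg.hasMatDerivAt t) hl h1).deriv, EuclideanSpace.norm_eq, speed]
  refine Real.sqrt_le_sqrt ?_
  set G := ((g t : SLn n) : Matrix (Fin n) (Fin n) ℂ)
  set V := velocity g t
  set q := l * G with hq
  set B := l * (V * Gᴴ + G * Vᴴ) * lᴴ with hB
  have hqq : q * qᴴ = 1 := by
    rw [hq, Matrix.conjTranspose_mul, ← h1]; simp only [Matrix.mul_assoc]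
  have hqq' : qᴴ * q = 1 := mul_eq_one_comm.1 hqq
  have hinv : (((g t)⁻¹ : SLn n) : Matrix (Fin n) (Fin n) ℂ) = qᴴ * l := by
    symm
    refine left_inv_eq_right_inv (a := G) ?_ (coe_mul_coe_inv (g t))
    rw [Matrix.mul_assoc, ← hq, hqq']
  have hBB : Bᴴ = B := by
    rw [hB]
    simp only [Matrix.conjTranspose_mul, Matrix.conjTranspose_add,
      Matrix.conjTranspose_conjTranspose, Matrix.mul_assoc]
    rw [add_comm]
  have hBq : B = l * V * qᴴ + q * (l * V)ᴴ := by
    rw [hB, hq]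
    simp only [Matrix.conjTranspose_mul, Matrix.mul_add, Matrix.add_mul, Matrix.mul_assoc]
  have hX : pPart ((((g t)⁻¹ : SLn n) : Matrix (Fin n) (Fin n) ℂ) * V) =
      (1 / 2 : ℂ) • (qᴴ * B * q) := by
    rw [pPart, hinv, hBq]
    congr 1
    simp only [Matrix.conjTranspose_mul, Matrix.mul_add, Matrix.add_mul, Matrix.mul_assoc, hqq',
      Matrix.mul_one, Matrix.conjTranspose_conjTranspose]
    congr 1
    simp only [← Matrix.mul_assoc, hqq', Matrix.one_mul]
  have htr : (qᴴ * B * q * (qᴴ * B * q)).trace = (B * B).trace := by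
    have : qᴴ * B * q * (qᴴ * B * q) = qᴴ * (B * (q * qᴴ) * B * q) := by
      simp only [Matrix.mul_assoc]
    rw [this, Matrix.trace_mul_comm, hqq, Matrix.mul_one, Matrix.mul_assoc, hqq, Matrix.mul_one]
  -- The factor `4n` of the Killing form meets `1/4` from the two halves. The remaining `n` is why
  -- `iwasawa` carries the factor `√n`.
  have hk : killingB ((1 / 2 : ℂ) • (qᴴ * B * q)) ((1 / 2 : ℂ) • (qᴴ * B * q)) =
      n * (B * B).trace.re := by
    rw [killingB, Matrix.smul_mul, Matrix.mul_smul, smul_smul, Matrix.trace_smul, htr]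
    have : ((1 / 2 : ℂ) * (1 / 2)) = ((1 / 4 : ℝ) : ℂ) := by push_cast; norm_num
    rw [this, smul_eq_mul, Complex.re_ofReal_mul]
    ring
  rw [hX, hk]
  have hn : (0 : ℝ) ≤ n := Nat.cast_nonneg n
  calc ∑ k, ‖Real.sqrt n * (B k k).re‖ ^ 2 = n * ∑ k, (B k k).re ^ 2 := by
        rw [Finset.mul_sum]
        refine Finset.sum_congr rfl fun k _ => ?_
        rw [Real.norm_eq_abs, sq_abs, mul_pow, Real.sq_sqrt hn]
    _ ≤ n * (B * B).trace.re := mul_le_mul_of_nonneg_left (sum_sq_re_diag_le hBB) hn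

theorem HasCurve.enorm_iwasawa_sub_le {n : ℕ} {z w : ZSpace n} {L : ℝ≥0∞} (h : HasCurve z w L) :
    ∀ a b : SLn n, tau a = z → tau b = w → ‖iwasawa b - iwasawa a‖ₑ ≤ L := by
  induction h with
  | c1 g hg =>
    intro a b ha hb
    rw [iwasawa_eq_of_tau_eq ha, iwasawa_eq_of_tau_eq hb]
    refine (enorm_sub_le_lintegral_deriv_of_contDiffOn_Icc
      (f := fun s => iwasawa (g s)) (contDiff_iwasawa hg).contDiffOn zero_le_one).trans ?_
    refine MeasureTheory.lintegral_mono fun t => ?_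
    rw [← ofReal_norm]
    exact ENNReal.ofReal_le_ofReal (norm_deriv_iwasawa_le_speed hg t)
  | @concat x y z L M _ _ h1 h2 =>
    intro a b ha hb
    obtain ⟨c, hc⟩ := exists_tau_eq y
    calc ‖iwasawa b - iwasawa a‖ₑ = ‖(iwasawa c - iwasawa a) + (iwasawa b - iwasawa c)‖ₑ := by
          congr 1; abel
      _ ≤ _ := (enorm_add_le _ _).trans (add_le_add (h1 a c ha hc) (h2 c b hc hb))

theorem enorm_iwasawa_sub_le {n : ℕ} (a b : SLn n) :
    ‖iwasawa b - iwasawa a‖ₑ ≤ riemDist (tau a) (tau b) :=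
  le_iInf₂ fun _ h => h.enorm_iwasawa_sub_le a b rfl rfl

/-- This is the equality case of `sum_sq_re_diag_le`. With `D` the real diagonal part, `Tr (B - D)²
= Tr B² - Tr D² ≤ 0`, yet the left side is the sum of the squared moduli of the entries of `B - D`.
-/
theorem eq_diagonal_of_trace_le {n : ℕ} {B : Matrix (Fin n) (Fin n) ℂ} (hB : Bᴴ = B)
    (h : (B * B).trace.re ≤ ∑ k, (B k k).re ^ 2) :
    B = Matrix.diagonal fun k => ((B k k).re : ℂ) := by
  set D : Matrix (Fin n) (Fin n) ℂ := Matrix.diagonal fun k => ((B k k).re : ℂ) with hD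
  have hDD : Dᴴ = D := by
    rw [hD, Matrix.diagonal_conjTranspose]
    congr 1
    ext i
    simp
  have hC : (B - D)ᴴ = B - D := by rw [Matrix.conjTranspose_sub, hB, hDD]
  have htr := trace_mul_self_re hC
  have e1 : (D * D).trace.re = ∑ k, (B k k).re ^ 2 := by
    rw [hD, Matrix.diagonal_mul_diagonal, Matrix.trace_diagonal, Complex.re_sum]
    refine Finset.sum_congr rfl fun k _ => ?_
    rw [← Complex.ofReal_mul, Complex.ofReal_re, sq]
  have e2 : (B * D).trace.re = ∑ k, (B k k).re ^ 2 := by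
    rw [Matrix.trace, Complex.re_sum]
    refine Finset.sum_congr rfl fun k _ => ?_
    rw [Matrix.diag_apply, hD, Matrix.mul_diagonal, Complex.re_mul_ofReal, sq]
  have e3 : ((B - D) * (B - D)).trace.re ≤ 0 := by
    rw [Matrix.sub_mul, Matrix.mul_sub, Matrix.mul_sub, Matrix.trace_sub, Matrix.trace_sub,
      Matrix.trace_sub, Matrix.trace_mul_comm D B]
    simp only [Complex.sub_re, e1, e2]
    linarith
  rw [htr] at e3
  have e4 : ∑ i, ∑ j, Complex.normSq ((B - D) i j) = 0 :=
    le_antisymm e3 (Finset.sum_nonneg fun i _ => Finset.sum_nonneg fun j _ =>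
      Complex.normSq_nonneg _)
  rw [← sub_eq_zero]
  ext i j
  have e5 := (Finset.sum_eq_zero_iff_of_nonneg fun i _ => Finset.sum_nonneg fun j _ =>
    Complex.normSq_nonneg ((B - D) i j)).1 e4 i (Finset.mem_univ i)
  exact Complex.normSq_eq_zero.1 ((Finset.sum_eq_zero_iff_of_nonneg fun j _ =>
    Complex.normSq_nonneg ((B - D) i j)).1 e5 j (Finset.mem_univ j))

/-- Both bounds must be equalities by the triangle inequality, and strict convexity puts `v` on the
segment from `0` to `w`. -/
theorem eq_smul_of_norm_le {E : Type*} [NormedAddCommGroup E] [InnerProductSpace ℝ E]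
    {v w : E} {r : ℝ} (h1 : ‖v‖ ≤ r * ‖w‖) (h2 : ‖w - v‖ ≤ (1 - r) * ‖w‖) : v = r • w := by
  have h3 : ‖w‖ ≤ ‖v‖ + ‖w - v‖ := by
    calc ‖w‖ = ‖v + (w - v)‖ := by congr 1; abel
      _ ≤ _ := norm_add_le _ _
  have h4 := eq_lineMap_of_dist_eq_mul_of_dist_eq_mul (x := (0 : E)) (y := v) (z := w) (r := r)
    (by rw [dist_zero_left, dist_zero_left]; linarith)
    (by rw [dist_zero_left, dist_comm, dist_eq_norm]; linarith)
  rw [h4, AffineMap.lineMap_apply_module, smul_zero, zero_add]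

/-! ### The flat of diagonal matrices -/

/-- The space of real diagonal matrices of trace zero. -/
def traceZero (n : ℕ) : Submodule ℝ (EuclideanSpace ℝ (Fin n)) where
  carrier := {v | ∑ i, v i = 0}
  add_mem' {a b} ha hb := by
    simp only [Set.mem_ofPred_eq, PiLp.add_apply, Finset.sum_add_distrib] at *
    rw [ha, hb, add_zero]
  zero_mem' := by simp
  smul_mem' c a ha := by
    simp only [Set.mem_ofPred_eq, PiLp.smul_apply, smul_eq_mul, ← Finset.mul_sum] at *
    rw [ha, mul_zero]

/-- `exp(diag Λ)` as an element of `SL(n, ℂ)`. -/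
def diagExp {n : ℕ} (Λ : traceZero n) : SLn n :=
  ⟨Matrix.diagonal fun i => (Real.exp (Λ.1 i) : ℂ), by
    have h : ∑ i, Λ.1 i = 0 := Λ.2
    rw [Matrix.det_diagonal, ← Complex.ofReal_prod, ← Real.exp_sum, h, Real.exp_zero,
      Complex.ofReal_one]⟩

theorem coe_diagExp {n : ℕ} (Λ : traceZero n) :
    (diagExp Λ : Matrix (Fin n) (Fin n) ℂ) = Matrix.diagonal fun i => (Real.exp (Λ.1 i) : ℂ) := rfl

theorem diagExp_add {n : ℕ} (Λ M : traceZero n) : diagExp (Λ + M) = diagExp Λ * diagExp M := by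
  apply Subtype.ext
  rw [Matrix.SpecialLinearGroup.coe_mul, coe_diagExp, coe_diagExp, coe_diagExp,
    Matrix.diagonal_mul_diagonal]
  congr 1
  ext i
  rw [← Complex.ofReal_mul, ← Real.exp_add]
  rfl

theorem diagExp_zero {n : ℕ} : diagExp (0 : traceZero n) = 1 := by
  apply Subtype.ext
  rw [coe_diagExp, Matrix.SpecialLinearGroup.coe_one, ← Matrix.diagonal_one]
  congr 1
  ext i
  simp

theorem diagExp_neg {n : ℕ} (Λ : traceZero n) : diagExp (-Λ) = (diagExp Λ)⁻¹ := by
  rw [eq_inv_iff_mul_eq_one, ← diagExp_add, neg_add_cancel, diagExp_zero]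

theorem diagExp_mul_conjTranspose {n : ℕ} (Λ : traceZero n) :
    (diagExp Λ : Matrix (Fin n) (Fin n) ℂ) * (diagExp Λ : Matrix (Fin n) (Fin n) ℂ)ᴴ =
      Matrix.diagonal fun i => (Real.exp (2 * Λ.1 i) : ℂ) := by
  rw [coe_diagExp, Matrix.diagonal_conjTranspose, Matrix.diagonal_mul_diagonal]
  congr 1
  ext i
  rw [Pi.star_apply, RCLike.star_def, Complex.conj_ofReal, ← Complex.ofReal_mul, ← Real.exp_add,
    two_mul]

/-- The 2 comes from `g gᴴ`, which squares the diagonal. The resulting factor `2√n` agrees with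
`speed_diagExp`, so the Lipschitz bound is sharp on the flat. -/
theorem iwasawa_diagExp {n : ℕ} (Λ : traceZero n) :
    iwasawa (diagExp Λ) = (2 * Real.sqrt n) • Λ.1 := by
  have hm : ∀ (p : Fin n → Prop) [DecidablePred p], Real.log (minor p
      ((diagExp Λ : Matrix (Fin n) (Fin n) ℂ) * (diagExp Λ : Matrix (Fin n) (Fin n) ℂ)ᴴ)).re =
      ∑ i : {i // p i}, 2 * Λ.1 i := by
    intro p _
    have : (Matrix.diagonal fun i => (Real.exp (2 * Λ.1 i) : ℂ)).toBlock p p =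
        Matrix.diagonal fun i : {i // p i} => (Real.exp (2 * Λ.1 i) : ℂ) :=
      Matrix.submatrix_diagonal _ _ Subtype.val_injective
    rw [diagExp_mul_conjTranspose, minor, this, Matrix.det_diagonal, ← Complex.ofReal_prod,
      Complex.ofReal_re, ← Real.exp_sum, Real.log_exp]
  ext k
  simp only [iwasawa, hm, PiLp.smul_apply, smul_eq_mul]
  rw [sum_subtype_le_sub_sum_subtype_lt (fun i => 2 * Λ.1 i)]
  ring

theorem iwasawa_one {n : ℕ} : iwasawa (1 : SLn n) = 0 := by
  rw [← diagExp_zero, iwasawa_diagExp]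
  simp

theorem hasMatDerivAt_diagExp {n : ℕ} (Λ : traceZero n) (t : ℝ) :
    HasMatDerivAt (fun s : ℝ => (diagExp (s • Λ) : Matrix (Fin n) (Fin n) ℂ))
      ((diagExp (t • Λ) : Matrix (Fin n) (Fin n) ℂ) * Matrix.diagonal fun i => (Λ.1 i : ℂ)) t := by
  intro i j
  simp only [coe_diagExp, Matrix.diagonal_mul_diagonal, Matrix.diagonal_apply]
  split_ifs with hij
  · have h : HasDerivAt (fun s : ℝ => Real.exp (s * Λ.1 i)) (Real.exp (t * Λ.1 i) * Λ.1 i) t :=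
      (hasDerivAt_mul_const (Λ.1 i)).exp
    have := h.ofReal_comp
    rw [Complex.ofReal_mul] at this
    exact this
  · exact hasDerivAt_const t 0

theorem isC1Curve_diagExp {n : ℕ} (Λ : traceZero n) :
    IsC1Curve fun s : ℝ => diagExp (s • Λ) := by
  intro i j
  simp only [coe_diagExp, Matrix.diagonal_apply]
  split_ifs with hij
  · have h : ContDiff ℝ 1 (fun s : ℝ => Real.exp (s * Λ.1 i)) :=
      (contDiff_id.mul contDiff_const).exp
    exact Complex.ofRealCLM.contDiff.comp h
  · exact contDiff_const

theorem speed_diagExp {n : ℕ} (Λ : traceZero n) (t : ℝ) :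
    speed (fun s : ℝ => diagExp (s • Λ)) t = 2 * Real.sqrt n * ‖Λ‖ := by
  have hv : velocity (fun s : ℝ => diagExp (s • Λ)) t =
      (diagExp (t • Λ) : Matrix (Fin n) (Fin n) ℂ) * Matrix.diagonal fun i => (Λ.1 i : ℂ) := by
    ext i j
    exact (hasMatDerivAt_diagExp Λ t i j).deriv
  have hp : pPart (Matrix.diagonal fun i => (Λ.1 i : ℂ)) =
      Matrix.diagonal fun i => (Λ.1 i : ℂ) := by
    rw [pPart, Matrix.diagonal_conjTranspose, Matrix.diagonal_add, ← Matrix.diagonal_smul]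
    congr 1
    ext i
    simp
    ring
  rw [speed, hv, ← Matrix.mul_assoc, coe_inv_mul_coe, Matrix.one_mul, hp]
  have hk : killingB (Matrix.diagonal fun i => (Λ.1 i : ℂ)) (Matrix.diagonal fun i => (Λ.1 i : ℂ)) =
      (2 * Real.sqrt n * ‖Λ‖) ^ 2 := by
    rw [killingB, Matrix.diagonal_mul_diagonal, Matrix.trace_diagonal, mul_pow, mul_pow,
      Real.sq_sqrt (Nat.cast_nonneg n), Submodule.coe_norm, EuclideanSpace.norm_sq_eq,
      Complex.re_sum]
    norm_num
    left
    refine Finset.sum_congr rfl fun i _ => ?_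
    ring
  dsimp only
  rw [hk, Real.sqrt_sq (by positivity)]

theorem riemDist_tau_mul {n : ℕ} (g a b : SLn n) :
    riemDist (tau (g * a)) (tau (g * b)) = riemDist (tau a) (tau b) := by
  rw [← smul_tau, ← smul_tau, riemDist_smul]

/-- The upper bound is the length of the explicit exponential curve. The lower bound is the
Lipschitz property of the Iwasawa projection, which is linear on the flat. -/
theorem riemDist_diagExp {n : ℕ} (g : SLn n) (Λ M : traceZero n) :
    riemDist (tau (g * diagExp Λ)) (tau (g * diagExp M)) =
      ENNReal.ofReal (2 * Real.sqrt n * ‖M - Λ‖) := by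
  rw [riemDist_tau_mul]
  refine le_antisymm ?_ ?_
  · have h : tau (diagExp Λ) = tau (diagExp Λ * 1) := by rw [mul_one]
    have h' : tau (diagExp M) = tau (diagExp Λ * diagExp (M - Λ)) := by
      rw [← diagExp_add, add_sub_cancel]
    rw [h, h', riemDist_tau_mul]
    have hc := HasCurve.c1 _ (isC1Curve_diagExp (M - Λ))
    rw [zero_smul, one_smul, diagExp_zero] at hc
    refine (riemDist_le hc).trans_eq ?_
    simp only [curveLength, speed_diagExp]
    simp
  · refine le_trans ?_ (enorm_iwasawa_sub_le _ _)
    rw [iwasawa_diagExp, iwasawa_diagExp, ← smul_sub, ← ofReal_norm, norm_smul,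
      Real.norm_of_nonneg (by positivity)]
    rfl

/-! ### Polar decomposition and uniqueness of segments. -/

theorem coe_mul_mul_conjTranspose {n : ℕ} (a b : SLn n) :
    ((a * b : SLn n) : Matrix (Fin n) (Fin n) ℂ) * ((a * b : SLn n) : Matrix (Fin n) (Fin n) ℂ)ᴴ =
      (a : Matrix (Fin n) (Fin n) ℂ) *
        ((b : Matrix (Fin n) (Fin n) ℂ) * (b : Matrix (Fin n) (Fin n) ℂ)ᴴ) *
        (a : Matrix (Fin n) (Fin n) ℂ)ᴴ := by
  rw [Matrix.SpecialLinearGroup.coe_mul, Matrix.conjTranspose_mul]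
  simp only [Matrix.mul_assoc]

/-- A unitary matrix can be scaled by a phase to have determinant one. -/
theorem exists_smul_eq_coe_SUn {n : ℕ} (hn : n ≠ 0) {U : Matrix (Fin n) (Fin n) ℂ}
    (hU : U * Uᴴ = 1) :
    ∃ (c : ℂ) (k : SLn n), c * conj c = 1 ∧ k ∈ SUn n ∧ (k : Matrix (Fin n) (Fin n) ℂ) = c • U := by
  have hdet : U.det * conj U.det = 1 := by
    have := congrArg Matrix.det hU
    rwa [Matrix.det_mul, Matrix.det_conjTranspose, Matrix.det_one] at this
  have hd0 : U.det ≠ 0 := left_ne_zero_of_mul_eq_one hdet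
  have hdn : ‖U.det‖ = 1 := by
    have h := congrArg norm hdet
    rw [norm_mul, RCLike.norm_conj, norm_one, ← sq] at h
    exact (pow_eq_one_iff_of_nonneg (norm_nonneg _) two_ne_zero).1 h
  obtain ⟨c, hc⟩ := IsAlgClosed.exists_pow_nat_eq (U.det)⁻¹ (Nat.pos_of_ne_zero hn)
  have hcn : ‖c‖ = 1 := by
    have h := congrArg norm hc
    rw [norm_pow, norm_inv, hdn, inv_one] at h
    exact (pow_eq_one_iff_of_nonneg (norm_nonneg c) hn).1 h
  have hcc : c * conj c = 1 := by
    rw [Complex.mul_conj, Complex.normSq_eq_norm_sq, hcn]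
    simp
  have hk : (c • U).det = 1 := by
    rw [Matrix.det_smul, Fintype.card_fin, hc, inv_mul_cancel₀ hd0]
  refine ⟨c, ⟨c • U, hk⟩, hcc, mem_SUn_iff.2 ?_, rfl⟩
  change (c • U) * (c • U)ᴴ = 1
  rw [Matrix.conjTranspose_smul, Matrix.smul_mul, Matrix.mul_smul, smul_smul, hU, RCLike.star_def,
    hcc, one_smul]

/-- This is the decomposition `G = K A K`, read off from the spectral theorem for `g gᴴ`. Λ consists
of half the logarithms of the eigenvalues, and the phase that makes the eigenvector matrix special
cancels in the congruence. -/
theorem exists_tau_mul_diagExp_eq {n : ℕ} (hn : n ≠ 0) (g : SLn n) :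
    ∃ k ∈ SUn n, ∃ Λ : traceZero n, tau (k * diagExp Λ) = tau g := by
  have hP := posDef_mul_conjTranspose g
  set P := (g : Matrix (Fin n) (Fin n) ℂ) * (g : Matrix (Fin n) (Fin n) ℂ)ᴴ with hPdef
  set d := hP.1.eigenvalues with hd
  have hd0 : ∀ i, 0 < d i := hP.eigenvalues_pos
  have hprod : ∏ i, d i = 1 := by
    have h1 : P.det = 1 := by
      rw [hPdef, Matrix.det_mul, Matrix.det_conjTranspose, g.det_coe, star_one, one_mul]
    rw [hP.1.det_eq_prod_eigenvalues] at h1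
    apply Complex.ofReal_injective
    rw [Complex.ofReal_prod, Complex.ofReal_one]
    exact h1
  have hsum : ∑ i, Real.log (d i) / 2 = 0 := by
    rw [← Finset.sum_div, ← Real.log_prod fun i _ => (hd0 i).ne', hprod, Real.log_one, zero_div]
  set U : Matrix (Fin n) (Fin n) ℂ := (hP.1.eigenvectorUnitary).1
  have hU : U * Uᴴ = 1 := Matrix.mem_unitaryGroup_iff.1 hP.1.eigenvectorUnitary.2
  have hspec : P = U * Matrix.diagonal (fun i => (d i : ℂ)) * Uᴴ := by
    have := hP.1.spectral_theorem
    rw [Unitary.conjStarAlgAut_apply] at this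
    exact this
  obtain ⟨c, k, hc, hk, hkU⟩ := exists_smul_eq_coe_SUn hn hU
  refine ⟨k, hk, ⟨WithLp.toLp 2 fun i => Real.log (d i) / 2, hsum⟩, ?_⟩
  rw [tau_eq_iff, ← hPdef, coe_mul_mul_conjTranspose,
        diagExp_mul_conjTranspose, hspec, hkU, Matrix.conjTranspose_smul, Matrix.mul_smul,
    Matrix.smul_mul, Matrix.smul_mul, smul_smul, RCLike.star_def, mul_comm (conj c), hc, one_smul]
  congr 3
  ext i
  simp only
  rw [mul_div_cancel₀ _ two_ne_zero, Real.exp_log (hd0 i)]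

theorem norm_iwasawa_sub_le {n : ℕ} {a b : SLn n} {r : ℝ} (hr : 0 ≤ r)
    (h : riemDist (tau a) (tau b) ≤ ENNReal.ofReal r) : ‖iwasawa b - iwasawa a‖ ≤ r := by
  have := (enorm_iwasawa_sub_le a b).trans h
  rwa [← ofReal_norm, ENNReal.ofReal_le_ofReal_iff hr] at this

/-- Entrywise, the intertwining relation says that `Λⱼ = Mᵢ` wherever `Kᵢⱼ ≠ 0`. It therefore
persists when a function, here `exp(2 ·)`, is applied to both diagonals. -/
theorem tau_mul_diagExp_eq_of_diagonal {n : ℕ} {k : SLn n} {Λ M : traceZero n} (hk : k ∈ SUn n)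
    (h : (k : Matrix (Fin n) (Fin n) ℂ) * (Matrix.diagonal fun i => (Λ.1 i : ℂ)) *
      (k : Matrix (Fin n) (Fin n) ℂ)ᴴ = Matrix.diagonal fun i => (M.1 i : ℂ)) :
    tau (k * diagExp Λ) = tau (diagExp M) := by
  rw [tau_eq_iff, coe_mul_mul_conjTranspose,
        diagExp_mul_conjTranspose, diagExp_mul_conjTranspose]
  have hkk := mem_SUn_iff.1 hk
  have hkk' := mem_SUn_iff'.1 hk
  set K := (k : Matrix (Fin n) (Fin n) ℂ)
  have h2 : K * (Matrix.diagonal fun i => (Λ.1 i : ℂ)) =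
      (Matrix.diagonal fun i => (M.1 i : ℂ)) * K := by
    rw [← h, Matrix.mul_assoc _ Kᴴ, hkk', Matrix.mul_one]
  have h3 : K * (Matrix.diagonal fun i => (Real.exp (2 * Λ.1 i) : ℂ)) =
      (Matrix.diagonal fun i => (Real.exp (2 * M.1 i) : ℂ)) * K := by
    ext i j
    have h4 := congrFun (congrFun h2 i) j
    rw [Matrix.mul_diagonal, Matrix.diagonal_mul] at h4 ⊢
    by_cases h0 : K i j = 0
    · rw [h0, zero_mul, mul_zero]
    · rw [mul_comm] at h4
      have h5 := Complex.ofReal_injective (mul_right_cancel₀ h0 h4)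
      rw [h5, mul_comm]
  rw [h3, Matrix.mul_assoc, hkk, Matrix.mul_one]

/-- Uniqueness of geodesic segments: points with the right distances to the end points of
a segment lie on it. -/
theorem eq_tau_mul_diagExp_of_riemDist_eq {n : ℕ} (hn : n ≠ 0) {g : SLn n} {Λ : traceZero n}
    {z : ZSpace n} {s : ℝ} (hs0 : 0 ≤ s) (hs1 : s ≤ 1)
    (h1 : riemDist (tau g) z = ENNReal.ofReal (s * (2 * Real.sqrt n * ‖Λ‖)))
    (h2 : riemDist z (tau (g * diagExp Λ)) = ENNReal.ofReal ((1 - s) * (2 * Real.sqrt n * ‖Λ‖))) :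
    z = tau (g * diagExp (s • Λ)) := by
  -- After translation by `g⁻¹` the segment starts at the base point and lies in the flat, and the
  -- unknown point is `k exp(M) u`.
  obtain ⟨y, hy⟩ := exists_tau_eq (g⁻¹ • z)
  obtain ⟨k, hk, M, hkM⟩ := exists_tau_mul_diagExp_eq hn y
  have hz : z = tau (g * (k * diagExp M)) := by
    rw [← smul_tau, hkM, hy, smul_inv_smul]
  have hk1 : tau k = tau (1 : SLn n) := by
    have := tau_mul_of_mem 1 hk
    rwa [one_mul] at this
  have hcn : 0 < 2 * Real.sqrt n := by
    have : (0 : ℝ) < n := by exact_mod_cast Nat.pos_of_ne_zero hn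
    positivity
  have hg1 : tau g = tau (g * 1) := by rw [mul_one]
  rw [hz, hg1, riemDist_tau_mul] at h1
  rw [hz, riemDist_tau_mul] at h2
  have h1' : riemDist (tau k) (tau (k * diagExp M)) = ENNReal.ofReal (2 * Real.sqrt n * ‖M‖) := by
    have := riemDist_diagExp k 0 M
    rwa [diagExp_zero, mul_one, sub_zero] at this
  have hMΛ : ‖M‖ = s * ‖Λ‖ := by
    rw [← hk1, h1', ENNReal.ofReal_eq_ofReal_iff (by positivity) (by positivity)] at h1
    have : 2 * Real.sqrt n * ‖M‖ = 2 * Real.sqrt n * (s * ‖Λ‖) := by rw [h1]; ring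
    exact mul_left_cancel₀ hcn.ne' this
  have hnorm : ∀ N : traceZero n, ‖iwasawa (diagExp N)‖ = 2 * Real.sqrt n * ‖N‖ := fun N => by
    rw [iwasawa_diagExp, norm_smul, Real.norm_of_nonneg hcn.le]
    rfl
  -- The projection shortens neither leg, since its image already spans the whole Euclidean
  -- distance. So the unknown point projects to the right place on the segment.
  have hy1 : iwasawa (k * diagExp M) = s • iwasawa (diagExp Λ) := by
    refine eq_smul_of_norm_le ?_ ?_
    · have := norm_iwasawa_sub_le (by positivity) h1.le
      rwa [iwasawa_one, sub_zero, ← hnorm] at this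
    · have := norm_iwasawa_sub_le (mul_nonneg (sub_nonneg.2 hs1) (by positivity)) h2.le
      rwa [← hnorm] at this
  set v := iwasawa (k * diagExp M) with hv
  have hvM : ‖v‖ = 2 * Real.sqrt n * ‖M‖ := by
    rw [hy1, norm_smul, hnorm, hMΛ, Real.norm_of_nonneg hs0]
    ring
  -- By the same rigidity, the segment from the base point to `k exp(M) u` projects to a straight
  -- line, with velocity `v`.
  have hline : ∀ t ∈ Set.Icc (0 : ℝ) 1, iwasawa (k * diagExp (t • M)) = t • v := by
    rintro t ⟨ht0, ht1⟩
    refine eq_smul_of_norm_le ?_ ?_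
    · have h := riemDist_diagExp k 0 (t • M)
      rw [diagExp_zero, mul_one, sub_zero, hk1] at h
      have := norm_iwasawa_sub_le (by positivity) h.le
      rw [iwasawa_one, sub_zero, norm_smul, Real.norm_of_nonneg ht0] at this
      rw [hvM]
      linarith
    · have h := riemDist_diagExp k (t • M) M
      have := norm_iwasawa_sub_le (by positivity) h.le
      have e : M - t • M = (1 - t) • M := by rw [sub_smul, one_smul]
      rw [e, norm_smul, Real.norm_of_nonneg (sub_nonneg.2 ht1)] at this
      rw [hvM]
      linarith
  have hkk := mem_SUn_iff.1 hk
  set K := (k : Matrix (Fin n) (Fin n) ℂ) with hK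
  set DM : Matrix (Fin n) (Fin n) ℂ := Matrix.diagonal fun i => (M.1 i : ℂ) with hDM
  have hDMh : DMᴴ = DM := by
    rw [hDM, Matrix.diagonal_conjTranspose]
    congr 1
    ext i
    simp
  have hcurve : HasMatDerivAt
      (fun t : ℝ => ((k * diagExp (t • M) : SLn n) : Matrix (Fin n) (Fin n) ℂ)) (K * DM) 0 := by
    have := (hasMatDerivAt_const K 0).mul (hasMatDerivAt_diagExp M 0)
    simp only [Matrix.SpecialLinearGroup.coe_mul]
    convert! this using 1
    rw [zero_smul, diagExp_zero, Matrix.SpecialLinearGroup.coe_one, Matrix.one_mul,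
      Matrix.zero_mul, zero_add]
  have hk0 : ((k * diagExp ((0 : ℝ) • M) : SLn n) : Matrix (Fin n) (Fin n) ℂ) = K := by
    rw [zero_smul, diagExp_zero, mul_one]
  -- At `t = 0` the matrix is `K Kᴴ = 1`, so no triangular correction is needed and the derivative
  -- is `2√n` times the diagonal of `K diag(M) Kᴴ`.
  have hderiv := hasDerivAt_iwasawa (l := 1) hcurve
    (fun i j hij => Matrix.one_apply_ne hij.ne) (by
      rw [hk0, hkk, Matrix.conjTranspose_one, Matrix.one_mul, Matrix.one_mul])
  rw [hk0, Matrix.conjTranspose_one, Matrix.one_mul, Matrix.mul_one, Matrix.conjTranspose_mul, hDMh,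
    ← Matrix.mul_assoc K DM] at hderiv
  have hderiv2 : HasDerivWithinAt (fun t : ℝ => iwasawa (k * diagExp (t • M))) v
      (Set.Icc 0 1) 0 := by
    have : HasDerivWithinAt (fun t : ℝ => t • v) v (Set.Icc 0 1) 0 := by
      have := (hasDerivAt_id (0 : ℝ)).smul_const v
      rw [one_smul] at this
      exact this.hasDerivWithinAt
    exact this.congr hline (hline 0 ⟨le_rfl, zero_le_one⟩)
  -- Linearity is known only on `[0, 1]`, so the derivatives at `0` are compared within that
  -- interval.
  have hvD := (uniqueDiffOn_Icc (zero_lt_one (α := ℝ)) 0 ⟨le_rfl, zero_le_one⟩).eq_deriv _ hderiv2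
    hderiv.hasDerivWithinAt
  set B := K * DM * Kᴴ with hB
  have hsq : Real.sqrt n ≠ 0 := fun h => by rw [h, mul_zero] at hcn; exact lt_irrefl _ hcn
  have hdiag : ∀ i, (B i i).re = s * Λ.1 i := by
    intro i
    have h3 := congrArg (fun w : EuclideanSpace ℝ (Fin n) => w i) (hvD.symm.trans hy1)
    simp only [Matrix.add_apply, Complex.add_re, iwasawa_diagExp, PiLp.smul_apply,
      smul_eq_mul] at h3
    have h4 : Real.sqrt n * (2 * (B i i).re) = Real.sqrt n * (2 * (s * Λ.1 i)) := by linarith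
    have := mul_left_cancel₀ hsq h4
    linarith
  have hBB : Bᴴ = B := by
    rw [hB, Matrix.conjTranspose_mul, Matrix.conjTranspose_mul, Matrix.conjTranspose_conjTranspose,
      hDMh, Matrix.mul_assoc]
  have hkk' := mem_SUn_iff'.1 hk
  have htr : (B * B).trace.re = ‖M‖ ^ 2 := by
    have : B * B = K * (DM * DM * Kᴴ) := by
      rw [hB]
      calc K * DM * Kᴴ * (K * DM * Kᴴ) = K * DM * (Kᴴ * K) * DM * Kᴴ := by
            simp only [Matrix.mul_assoc]
        _ = _ := by rw [hkk', Matrix.mul_one]; simp only [Matrix.mul_assoc]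
    rw [this, Matrix.trace_mul_comm, Matrix.mul_assoc, hkk', Matrix.mul_one, hDM,
      Matrix.diagonal_mul_diagonal, Matrix.trace_diagonal, Complex.re_sum, Submodule.coe_norm,
      EuclideanSpace.norm_sq_eq]
    refine Finset.sum_congr rfl fun i _ => ?_
    rw [← Complex.ofReal_mul, Complex.ofReal_re, Real.norm_eq_abs, sq_abs, sq]
  -- The diagonal of `B` is `sΛ`, whose norm `s‖Λ‖ = ‖M‖` is already the Frobenius norm of `B`.
  -- Hence `B = diag(sΛ)`.
  have hBdiag := eq_diagonal_of_trace_le hBB (by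
    rw [htr, hMΛ, mul_pow, Submodule.coe_norm, EuclideanSpace.norm_sq_eq, Finset.mul_sum]
    refine Finset.sum_le_sum fun i _ => ?_
    rw [hdiag, mul_pow, Real.norm_eq_abs, sq_abs])
  simp only [hdiag] at hBdiag
  rw [hz, ← smul_tau, tau_mul_diagExp_eq_of_diagonal (M := s • Λ) hk hBdiag, smul_tau]

/-! ### Classification of complete geodesics -/

theorem gram_mul_diagExp {n : ℕ} (g : SLn n) (Λ : traceZero n) :
    ((g * diagExp Λ : SLn n) : Matrix (Fin n) (Fin n) ℂ) *
        ((g * diagExp Λ : SLn n) : Matrix (Fin n) (Fin n) ℂ)ᴴ =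
      (g : Matrix (Fin n) (Fin n) ℂ) * Matrix.diagonal (fun i => (Real.exp (2 * Λ.1 i) : ℂ)) *
        (g : Matrix (Fin n) (Fin n) ℂ)ᴴ := by
  rw [coe_mul_mul_conjTranspose, diagExp_mul_conjTranspose]

theorem gram_mul_diagExp_apply {n : ℕ} (g : SLn n) (Λ : traceZero n) (i j : Fin n) :
    (((g * diagExp Λ : SLn n) : Matrix (Fin n) (Fin n) ℂ) *
        ((g * diagExp Λ : SLn n) : Matrix (Fin n) (Fin n) ℂ)ᴴ) i j =
      ∑ k, (g : Matrix (Fin n) (Fin n) ℂ) i k * (Real.exp (2 * Λ.1 k) : ℂ) *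
        conj ((g : Matrix (Fin n) (Fin n) ℂ) j k) := by
  rw [gram_mul_diagExp, Matrix.mul_apply]
  refine Finset.sum_congr rfl fun k _ => ?_
  rw [Matrix.mul_diagonal, Matrix.conjTranspose_apply, RCLike.star_def]

/-- The entries of `g gᴴ` along such a curve are combinations of real exponentials in `t`, hence
analytic, so the germ at one time determines the curve. -/
theorem eq_of_eventuallyEq_tau {n : ℕ} {g g' : SLn n} {Λ Λ' : traceZero n} {t₀ : ℝ}
    (h : (fun t : ℝ => tau (g * diagExp (t • Λ))) =ᶠ[𝓝 t₀]
      fun t : ℝ => tau (g' * diagExp (t • Λ'))) :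
    (fun t : ℝ => tau (g * diagExp (t • Λ))) = fun t : ℝ => tau (g' * diagExp (t • Λ')) := by
  have hana : ∀ (g : SLn n) (Λ : traceZero n) (i j : Fin n), AnalyticOnNhd ℝ (fun t : ℝ =>
      (((g * diagExp (t • Λ) : SLn n) : Matrix (Fin n) (Fin n) ℂ) *
        ((g * diagExp (t • Λ) : SLn n) : Matrix (Fin n) (Fin n) ℂ)ᴴ) i j) Set.univ := by
    intro g Λ i j t _
    simp only [gram_mul_diagExp_apply]
    refine Finset.analyticAt_fun_sum _ fun k _ => ?_
    have h1 : AnalyticAt ℝ (fun t : ℝ => Real.exp (2 * (t * Λ.1 k))) t := by fun_prop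
    have h2 : AnalyticAt ℝ (fun t : ℝ => (Real.exp (2 * (t * Λ.1 k)) : ℂ)) t :=
      (Complex.ofRealCLM.analyticAt _).comp h1
    exact (analyticAt_const.mul h2).mul analyticAt_const
  have key : ∀ i j, _ := fun i j => (hana g Λ i j).eq_of_eventuallyEq (hana g' Λ' i j) (z₀ := t₀) (by
    filter_upwards [h] with t ht
    rw [tau_eq_iff] at ht
    rw [ht])
  ext t
  rw [tau_eq_iff]
  ext i j
  exact congrFun (key i j) t

theorem Geodesic.eventually_eq {n : ℕ} (hn : n ≠ 0) (γ : Geodesic n) (t₀ : ℝ) :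
    ∃ (g : SLn n) (Λ : traceZero n), 2 * Real.sqrt n * ‖Λ‖ = 1 ∧
      ∀ᶠ t in 𝓝 t₀, γ.1 t = tau (g * diagExp (t • Λ)) := by
  obtain ⟨U, hU, hγ⟩ := γ.2 t₀
  obtain ⟨ε, hε, hεU⟩ := Metric.nhds_basis_closedBall.mem_iff.1 hU
  rw [Real.closedBall_eq_Icc] at hεU
  set a := t₀ - ε with ha
  set b := t₀ + ε with hb
  have hab : 0 < b - a := by rw [ha, hb]; linarith
  obtain ⟨g₀, hg₀⟩ := exists_tau_eq (γ.1 a)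
  obtain ⟨y, hy⟩ := exists_tau_eq (g₀⁻¹ • γ.1 b)
  obtain ⟨k, hk, Λ₀, hΛ₀⟩ := exists_tau_mul_diagExp_eq hn y
  have h1 : tau (g₀ * k) = γ.1 a := by rw [tau_mul_of_mem _ hk, hg₀]
  have h2 : tau (g₀ * k * diagExp Λ₀) = γ.1 b := by
    rw [mul_assoc, ← smul_tau, hΛ₀, hy, smul_inv_smul]
  have hd : ∀ s ∈ Set.Icc a b, ∀ t ∈ Set.Icc a b, s ≤ t →
      riemDist (γ.1 s) (γ.1 t) = ENNReal.ofReal (t - s) := by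
    intro s hs t ht hst
    rw [hγ s (hεU hs) t (hεU ht), edist_comm, edist_dist, Real.dist_eq,
      abs_of_nonneg (sub_nonneg.2 hst)]
  have hma : a ∈ Set.Icc a b := ⟨le_rfl, by linarith⟩
  have hmb : b ∈ Set.Icc a b := ⟨by linarith, le_rfl⟩
  have hN : 2 * Real.sqrt n * ‖Λ₀‖ = b - a := by
    have h3 := riemDist_diagExp (g₀ * k) 0 Λ₀
    rw [diagExp_zero, mul_one, sub_zero, h1, h2, hd a hma b hmb (by linarith)] at h3
    exact ((ENNReal.ofReal_eq_ofReal_iff hab.le (by positivity)).1 h3).symm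
  -- The diagonal factor moves the origin of the parameter from `a` to `0`, so that `t` itself is
  -- the parameter. This makes the formulas around different `t₀` comparable.
  refine ⟨g₀ * k * diagExp (-(a / (b - a)) • Λ₀), (b - a)⁻¹ • Λ₀, ?_, ?_⟩
  · rw [norm_smul, Real.norm_of_nonneg (inv_nonneg.2 hab.le)]
    calc 2 * Real.sqrt n * ((b - a)⁻¹ * ‖Λ₀‖) = (b - a)⁻¹ * (2 * Real.sqrt n * ‖Λ₀‖) := by ring
      _ = 1 := by rw [hN, inv_mul_cancel₀ hab.ne']
  · filter_upwards [Icc_mem_nhds (show a < t₀ by linarith) (show t₀ < b by linarith)] with t ht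
    rw [mul_assoc, ← diagExp_add, smul_smul, ← add_smul]
    have hs : -(a / (b - a)) + t * (b - a)⁻¹ = (t - a) / (b - a) := by field_simp; ring
    rw [hs]
    refine eq_tau_mul_diagExp_of_riemDist_eq hn (div_nonneg (by linarith [ht.1]) hab.le)
      ((div_le_one hab).2 (by linarith [ht.2])) ?_ ?_
    · rw [h1, hN, hd a hma t ht ht.1, div_mul_cancel₀ _ hab.ne']
    · rw [h2, hN, hd t ht b hmb ht.2]
      congr 1
      field_simp
      ring

theorem Geodesic.exists_eq {n : ℕ} (hn : n ≠ 0) (γ : Geodesic n) :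
    ∃ (g : SLn n) (Λ : traceZero n), 2 * Real.sqrt n * ‖Λ‖ = 1 ∧
      ∀ t, γ.1 t = tau (g * diagExp (t • Λ)) := by
  choose g Λ hΛ h using γ.eventually_eq hn
  -- The whole curve attached to `t₀` is locally constant in `t₀`, since neighbouring curves share a
  -- germ. As ℝ is connected, one formula serves for all times.
  have hloc : IsLocallyConstant fun t₀ : ℝ => fun t : ℝ => tau (g t₀ * diagExp (t • Λ t₀)) := by
    rw [IsLocallyConstant.iff_eventually_eq]
    intro t₀
    filter_upwards [(h t₀).eventually_nhds] with t₁ ht₁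
    refine eq_of_eventuallyEq_tau (t₀ := t₁) ?_
    filter_upwards [ht₁, h t₁] with t hta htb
    rw [← hta, ← htb]
  refine ⟨g 0, Λ 0, hΛ 0, fun t => ?_⟩
  rw [(h t).self_of_nhds]
  exact congrFun (hloc.apply_eq_of_isPreconnected isPreconnected_univ (Set.mem_univ t)
    (Set.mem_univ 0)) t

theorem isUnitSpeedGeodesic_tau_mul_diagExp {n : ℕ} (g : SLn n) {Λ : traceZero n}
    (hΛ : 2 * Real.sqrt n * ‖Λ‖ = 1) :
    IsUnitSpeedGeodesic fun t : ℝ => tau (g * diagExp (t • Λ)) := by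
  refine fun t₀ => ⟨Set.univ, Filter.univ_mem, fun s _ t _ => ?_⟩
  rw [riemDist_diagExp, ← sub_smul, norm_smul, edist_comm, edist_dist, Real.dist_eq,
    Real.norm_eq_abs]
  congr 1
  rw [mul_left_comm, hΛ, mul_one]

/-! ### Stabilizers of boundary points -/

/-- Together with `exists_riemDist_le_of_norm_apply_le`, this says that distance to the base point
is bounded iff the matrix entries are, which turns asymptoticity into algebra. -/
theorem norm_apply_le_of_riemDist_le {n : ℕ} (hn : n ≠ 0) {y : SLn n} {C : ℝ} (hC : 0 ≤ C)
    (h : riemDist (tau y) (tau 1) ≤ ENNReal.ofReal C) (i j : Fin n) :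
    ‖(y : Matrix (Fin n) (Fin n) ℂ) i j‖ ≤ Real.exp C := by
  obtain ⟨k, hk, M, hkM⟩ := exists_tau_mul_diagExp_eq hn y
  have hk1 : tau (1 : SLn n) = tau (k * diagExp 0) := by
    rw [diagExp_zero, mul_one, ← tau_mul_of_mem 1 hk, one_mul]
  rw [← hkM, hk1, riemDist_diagExp, zero_sub, norm_neg, ENNReal.ofReal_le_ofReal_iff hC] at h
  have hn1 : 1 ≤ Real.sqrt n := Real.one_le_sqrt.2 (by exact_mod_cast Nat.pos_of_ne_zero hn)
  have hM : ∀ l, M.1 l ≤ C := fun l => by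
    have h1 : ‖M.1 l‖ ≤ ‖M‖ := PiLp.norm_apply_le M.1 l
    have h2 := (le_abs_self (M.1 l)).trans h1
    nlinarith [norm_nonneg M]
  have hgram := tau_eq_iff.1 hkM
  have hii := congrFun (congrFun hgram i) i
  rw [gram_mul_diagExp_apply, Matrix.mul_apply] at hii
  have hre := congrArg Complex.re hii
  rw [Complex.re_sum, Complex.re_sum] at hre
  have hkk := congrArg Complex.re (congrFun (congrFun (mem_SUn_iff.1 hk) i) i)
  rw [Matrix.mul_apply, Matrix.one_apply_eq, Complex.re_sum, Complex.one_re] at hkk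
  have e1 : ∀ l, ((y : Matrix (Fin n) (Fin n) ℂ) i l *
      (y : Matrix (Fin n) (Fin n) ℂ)ᴴ l i).re = ‖(y : Matrix (Fin n) (Fin n) ℂ) i l‖ ^ 2 := by
    intro l
    rw [Matrix.conjTranspose_apply, RCLike.star_def, Complex.mul_conj, Complex.ofReal_re,
      Complex.normSq_eq_norm_sq]
  have e2 : ∀ l, ((k : Matrix (Fin n) (Fin n) ℂ) i l *
      (k : Matrix (Fin n) (Fin n) ℂ)ᴴ l i).re = ‖(k : Matrix (Fin n) (Fin n) ℂ) i l‖ ^ 2 := by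
    intro l
    rw [Matrix.conjTranspose_apply, RCLike.star_def, Complex.mul_conj, Complex.ofReal_re,
      Complex.normSq_eq_norm_sq]
  have e3 : ∀ l, ((k : Matrix (Fin n) (Fin n) ℂ) i l * (Real.exp (2 * M.1 l) : ℂ) *
      conj ((k : Matrix (Fin n) (Fin n) ℂ) i l)).re =
      Real.exp (2 * M.1 l) * ‖(k : Matrix (Fin n) (Fin n) ℂ) i l‖ ^ 2 := by
    intro l
    rw [mul_right_comm, Complex.mul_conj, ← Complex.ofReal_mul, Complex.ofReal_re,
      Complex.normSq_eq_norm_sq, mul_comm]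
  simp only [e1, e2, e3] at hre hkk
  have hsq : ‖(y : Matrix (Fin n) (Fin n) ℂ) i j‖ ^ 2 ≤ Real.exp C ^ 2 := by
    calc ‖(y : Matrix (Fin n) (Fin n) ℂ) i j‖ ^ 2
        ≤ ∑ l, ‖(y : Matrix (Fin n) (Fin n) ℂ) i l‖ ^ 2 :=
          Finset.single_le_sum (f := fun l => ‖(y : Matrix (Fin n) (Fin n) ℂ) i l‖ ^ 2)
            (fun _ _ => sq_nonneg _) (Finset.mem_univ j)
      _ = ∑ l, Real.exp (2 * M.1 l) * ‖(k : Matrix (Fin n) (Fin n) ℂ) i l‖ ^ 2 := hre.symm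
      _ ≤ ∑ l, Real.exp (2 * C) * ‖(k : Matrix (Fin n) (Fin n) ℂ) i l‖ ^ 2 :=
          Finset.sum_le_sum fun l _ => mul_le_mul_of_nonneg_right
            (Real.exp_le_exp.2 (by linarith [hM l])) (sq_nonneg _)
      _ = Real.exp C ^ 2 := by
          rw [← Finset.mul_sum, hkk, mul_one, two_mul, Real.exp_add, sq]
  exact (pow_le_pow_iff_left₀ (norm_nonneg _) (Real.exp_pos _).le two_ne_zero).1 hsq

theorem exists_riemDist_le_of_norm_apply_le {n : ℕ} (hn : n ≠ 0) {R : ℝ} :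
    ∃ D : ℝ, ∀ y : SLn n, (∀ i j, ‖(y : Matrix (Fin n) (Fin n) ℂ) i j‖ ≤ R) →
      riemDist (tau y) (tau 1) ≤ ENNReal.ofReal D := by
  set S : ℝ := ∑ _i : Fin n, ∑ _j : Fin n, R ^ 2 with hS
  set L : ℝ := |Real.log S / 2| with hL
  refine ⟨2 * Real.sqrt n * (n * (n * L)), fun y hy => ?_⟩
  obtain ⟨k, hk, M, hkM⟩ := exists_tau_mul_diagExp_eq hn y
  have hk1 : tau (1 : SLn n) = tau (k * diagExp 0) := by
    rw [diagExp_zero, mul_one, ← tau_mul_of_mem 1 hk, one_mul]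
  have hgram := congrArg (fun A : Matrix (Fin n) (Fin n) ℂ => A.trace.re) (tau_eq_iff.1 hkM)
  rw [gram_mul_diagExp, Matrix.mul_assoc, Matrix.trace_mul_comm, Matrix.mul_assoc,
    mem_SUn_iff'.1 hk, Matrix.mul_one, Matrix.trace_diagonal, ← Complex.ofReal_sum,
    Complex.ofReal_re] at hgram
  have hn0 : (1 : ℝ) ≤ n := by exact_mod_cast Nat.pos_of_ne_zero hn
  have htr : ∑ i, Real.exp (2 * M.1 i) ≤ S := by
    rw [hgram, Matrix.trace, Complex.re_sum]
    refine Finset.sum_le_sum fun i _ => ?_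
    rw [Matrix.diag_apply, Matrix.mul_apply, Complex.re_sum]
    refine Finset.sum_le_sum fun j _ => ?_
    rw [Matrix.conjTranspose_apply, RCLike.star_def, Complex.mul_conj, Complex.ofReal_re,
      Complex.normSq_eq_norm_sq]
    exact pow_le_pow_left₀ (norm_nonneg _) (hy i j) 2
  have hL0 : 0 ≤ L := abs_nonneg _
  have hle : ∀ i, M.1 i ≤ L := fun i => by
    have h1 : Real.exp (2 * M.1 i) ≤ S := (Finset.single_le_sum
      (f := fun i => Real.exp (2 * M.1 i)) (fun _ _ => (Real.exp_pos _).le)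
      (Finset.mem_univ i)).trans htr
    have h2 := Real.log_le_log (Real.exp_pos _) h1
    rw [Real.log_exp] at h2
    have := le_abs_self (Real.log S / 2)
    linarith
  -- Trace zero turns the common upper bound into a lower bound: the nonnegative gaps `L - Mⱼ` add
  -- up to `nL`.
  have hge : ∀ i, -(n * L) ≤ M.1 i := fun i => by
    have h0 : ∑ j, M.1 j = 0 := M.2
    have h1 : ∑ j, (L - M.1 j) = n * L := by
      rw [Finset.sum_sub_distrib, h0, sub_zero, Finset.sum_const, Finset.card_univ,
        Fintype.card_fin, nsmul_eq_mul]
    have h2 := Finset.single_le_sum (f := fun j => L - M.1 j)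
      (fun j _ => sub_nonneg.2 (hle j)) (Finset.mem_univ i)
    rw [h1] at h2
    linarith
  have habs : ∀ i, ‖M.1 i‖ ≤ n * L := fun i => by
    rw [Real.norm_eq_abs, abs_le]
    exact ⟨hge i, (hle i).trans (by nlinarith)⟩
  have hnorm : ‖M‖ ≤ n * (n * L) := by
    rw [Submodule.coe_norm, EuclideanSpace.norm_eq]
    refine Real.sqrt_le_iff.2 ⟨by positivity, ?_⟩
    calc ∑ i, ‖M.1 i‖ ^ 2 ≤ ∑ _i : Fin n, (n * L) ^ 2 :=
          Finset.sum_le_sum fun i _ => pow_le_pow_left₀ (norm_nonneg _) (habs i) 2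
      _ = n * (n * L) ^ 2 := by
          rw [Finset.sum_const, Finset.card_univ, Fintype.card_fin, nsmul_eq_mul]
      _ ≤ (n * (n * L)) ^ 2 := by
          rw [mul_pow (n : ℝ) (n * L), sq (n : ℝ)]
          exact mul_le_mul_of_nonneg_right (by nlinarith) (sq_nonneg _)
  rw [← hkM, hk1, riemDist_diagExp, zero_sub, norm_neg]
  exact ENNReal.ofReal_le_ofReal (mul_le_mul_of_nonneg_left hnorm (by positivity))

theorem conj_diagExp_apply {n : ℕ} (b : SLn n) (Λ : traceZero n) (i j : Fin n) :
    (((diagExp Λ)⁻¹ * (b * diagExp Λ) : SLn n) : Matrix (Fin n) (Fin n) ℂ) i j =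
      (Real.exp (Λ.1 j - Λ.1 i) : ℂ) * (b : Matrix (Fin n) (Fin n) ℂ) i j := by
  rw [← diagExp_neg, Matrix.SpecialLinearGroup.coe_mul, Matrix.SpecialLinearGroup.coe_mul,
    coe_diagExp, coe_diagExp, Matrix.diagonal_mul, Matrix.mul_diagonal, sub_eq_neg_add,
    Real.exp_add, Complex.ofReal_mul]
  simp only [Submodule.coe_neg, PiLp.neg_apply]
  ring

/-- Conjugation by `exp(tΛ)` multiplies the entry `(i, j)` by `exp(t(Λⱼ - Λᵢ))`, which is unbounded
for `t ≥ 0` exactly when `Λᵢ < Λⱼ`. -/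
theorem exists_riemDist_le_iff {n : ℕ} (hn : n ≠ 0) (b : SLn n) (Λ : traceZero n) :
    (∃ C : ℝ≥0, ∀ t : ℝ≥0, riemDist (tau (b * diagExp ((t : ℝ) • Λ)))
      (tau (diagExp ((t : ℝ) • Λ))) ≤ C) ↔
    ∀ i j, Λ.1 i < Λ.1 j → (b : Matrix (Fin n) (Fin n) ℂ) i j = 0 := by
  have hd : ∀ t : ℝ, riemDist (tau (b * diagExp (t • Λ))) (tau (diagExp (t • Λ))) =
      riemDist (tau ((diagExp (t • Λ))⁻¹ * (b * diagExp (t • Λ)))) (tau 1) := fun t => by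
    rw [← riemDist_tau_mul (diagExp (t • Λ))⁻¹, inv_mul_cancel]
  simp only [hd]
  constructor
  · rintro ⟨C, hC⟩ i j hij
    by_contra hb
    have hbound : ∀ t : ℝ≥0, Real.exp (t * (Λ.1 j - Λ.1 i)) ≤
        Real.exp C / ‖(b : Matrix (Fin n) (Fin n) ℂ) i j‖ := by
      intro t
      have h1 := norm_apply_le_of_riemDist_le hn C.2 ((hC t).trans_eq
        (ENNReal.ofReal_coe_nnreal).symm) i j
      rw [conj_diagExp_apply, norm_mul, Complex.norm_real, Real.norm_of_nonneg (Real.exp_pos _).le]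
        at h1
      rw [le_div_iff₀ (norm_pos_iff.2 hb), mul_sub]
      exact h1
    have hpos : 0 < Λ.1 j - Λ.1 i := sub_pos.2 hij
    set E := Real.exp C / ‖(b : Matrix (Fin n) (Fin n) ℂ) i j‖ with hE
    have hE0 : 0 < E := div_pos (Real.exp_pos _) (norm_pos_iff.2 hb)
    -- At this time the bound reads `exp E ≤ E`, which is absurd.
    have h2 := hbound ⟨E / (Λ.1 j - Λ.1 i), div_nonneg hE0.le hpos.le⟩
    change Real.exp (E / (Λ.1 j - Λ.1 i) * (Λ.1 j - Λ.1 i)) ≤ E at h2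
    rw [div_mul_cancel₀ _ hpos.ne'] at h2
    linarith [Real.add_one_le_exp E]
  · intro h
    set R : ℝ := ∑ i, ∑ j, ‖(b : Matrix (Fin n) (Fin n) ℂ) i j‖ with hR
    obtain ⟨D, hD⟩ := exists_riemDist_le_of_norm_apply_le hn (R := R)
    refine ⟨D.toNNReal, fun t => hD _ fun i j => ?_⟩
    have hle : ‖(b : Matrix (Fin n) (Fin n) ℂ) i j‖ ≤ R :=
      (Finset.single_le_sum (f := fun j => ‖(b : Matrix (Fin n) (Fin n) ℂ) i j‖)
        (fun _ _ => norm_nonneg _) (Finset.mem_univ j)).trans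
      (Finset.single_le_sum (f := fun i => ∑ j, ‖(b : Matrix (Fin n) (Fin n) ℂ) i j‖)
        (fun _ _ => Finset.sum_nonneg fun _ _ => norm_nonneg _) (Finset.mem_univ i))
    rw [conj_diagExp_apply, norm_mul, Complex.norm_real, Real.norm_of_nonneg (Real.exp_pos _).le]
    by_cases hij : Λ.1 i < Λ.1 j
    · rw [h i j hij, norm_zero, mul_zero]
      exact (norm_nonneg _).trans hle
    · refine le_trans (mul_le_of_le_one_left (norm_nonneg _) (Real.exp_le_one_iff.2 ?_)) hle
      have : t * Λ.1 j ≤ t * Λ.1 i := mul_le_mul_of_nonneg_left (not_lt.1 hij) t.2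
      exact sub_nonpos.2 this

theorem mem_stabilizer_mk_iff {n : ℕ} (hn : n ≠ 0) {c : Boundary n} {ray : Ray n}
    (hc : c = Quotient.mk _ ray) {g : SLn n} {Λ : traceZero n}
    (hray : ∀ t : ℝ≥0, ray.1 t = tau (g * diagExp ((t : ℝ) • Λ))) (a : SLn n) :
    a ∈ MulAction.stabilizer (SLn n) c ↔
      ∀ i j, Λ.1 i < Λ.1 j → ((g⁻¹ * a * g : SLn n) : Matrix (Fin n) (Fin n) ℂ) i j = 0 := by
  rw [MulAction.mem_stabilizer_iff, ← exists_riemDist_le_iff hn]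
  subst hc
  change (Quotient.mk (asymptoticSetoid n) (a • ray)) = Quotient.mk _ ray ↔ _
  rw [Quotient.eq]
  change (∃ C : ℝ≥0, ∀ t : ℝ≥0, riemDist (a • ray.1 t) (ray.1 t) ≤ C) ↔ _
  simp only [hray, smul_tau]
  have : ∀ t : ℝ≥0, riemDist (tau (a * (g * diagExp ((t : ℝ) • Λ))))
      (tau (g * diagExp ((t : ℝ) • Λ))) = riemDist (tau (g⁻¹ * a * g * diagExp ((t : ℝ) • Λ)))
      (tau (diagExp ((t : ℝ) • Λ))) := fun t => by
    rw [← riemDist_tau_mul g (g⁻¹ * a * g * diagExp ((t : ℝ) • Λ))]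
    congr 2
    group
  simp only [this]

theorem isBoundaryPointOf_endPos_iff {n : ℕ} (hn : n ≠ 0) {γ : Geodesic n} {g : SLn n}
    {Λ : traceZero n} (hγ : ∀ t, γ.1 t = tau (g * diagExp (t • Λ)))
    (W : Submodule ℂ (Fin n → ℂ)) :
    IsBoundaryPointOf γ.endPos W ↔ ∀ a : SLn n,
      (∀ i j, Λ.1 i < Λ.1 j → ((g⁻¹ * a * g : SLn n) : Matrix (Fin n) (Fin n) ℂ) i j = 0) ↔
        W.map (Matrix.toLin' (a : Matrix (Fin n) (Fin n) ℂ)) = W :=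
  forall_congr' fun a => by
    rw [mem_stabilizer_mk_iff hn (c := γ.endPos) rfl (g := g) (Λ := Λ) fun t => hγ t]

theorem isBoundaryPointOf_endNeg_iff {n : ℕ} (hn : n ≠ 0) {γ : Geodesic n} {g : SLn n}
    {Λ : traceZero n} (hγ : ∀ t, γ.1 t = tau (g * diagExp (t • Λ)))
    (W : Submodule ℂ (Fin n → ℂ)) :
    IsBoundaryPointOf γ.endNeg W ↔ ∀ a : SLn n,
      (∀ i j, Λ.1 j < Λ.1 i → ((g⁻¹ * a * g : SLn n) : Matrix (Fin n) (Fin n) ℂ) i j = 0) ↔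
        W.map (Matrix.toLin' (a : Matrix (Fin n) (Fin n) ℂ)) = W :=
  forall_congr' fun a => by
    rw [mem_stabilizer_mk_iff hn (c := γ.endNeg) rfl (g := g) (Λ := -Λ) fun t => by
      rw [smul_neg, ← neg_smul]; exact hγ (-t)]
    simp only [Submodule.coe_neg, PiLp.neg_apply, neg_lt_neg_iff]

/-! ### Subspaces invariant under a maximal parabolic subgroup -/

/-- The rank-one perturbation has determinant `1 + φ v = 1`. These elements are used to move vectors
while preserving a chosen subspace. -/
theorem exists_transvection {n : ℕ} (φ : (Fin n → ℂ) →ₗ[ℂ] ℂ) {v : Fin n → ℂ} (h : φ v = 0) :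
    ∃ a : SLn n, ∀ x, (a : Matrix (Fin n) (Fin n) ℂ) *ᵥ x = x + φ x • v := by
  set f : Fin n → ℂ := fun i => φ (Pi.single i 1) with hf
  have hφ : ∀ x, f ⬝ᵥ x = φ x := fun x => by
    rw [LinearMap.pi_apply_eq_sum_univ φ x, dotProduct]
    refine Finset.sum_congr rfl fun i _ => ?_
    have : (Pi.single i 1 : Fin n → ℂ) = fun j => if i = j then 1 else 0 := by
      ext j; simp [Pi.single_apply, eq_comm]
    rw [smul_eq_mul, mul_comm, hf]
    simp only [this]
  refine ⟨⟨1 + Matrix.replicateCol Unit v * Matrix.replicateRow Unit f, ?_⟩, fun x => ?_⟩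
  · rw [Matrix.det_one_add_replicateCol_mul_replicateRow, hφ, h, add_zero]
  · change (1 + Matrix.replicateCol Unit v * Matrix.replicateRow Unit f) *ᵥ x = _
    rw [Matrix.add_mulVec, Matrix.one_mulVec, ← Matrix.vecMulVec_eq, Matrix.vecMulVec_mulVec, hφ]
    congr 1
    ext i
    simp [mul_comm]

/-- If `V ≤ W`, transvections along `v ∈ W` preserve W, and applied to some `x ∈ V` they force `v ∈
V`. If instead `x ∈ V` lies outside W, a functional killing W but not `x` gives transvections fixing
W pointwise. They force the kernel of that functional into V, and with `x` this makes V everything.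
-/
theorem eq_of_invariant {n : ℕ} {V W : Submodule ℂ (Fin n → ℂ)} (hV : V ≠ ⊥) (hV' : V ≠ ⊤)
    (h : ∀ a : SLn n, (∀ w ∈ W, (a : Matrix (Fin n) (Fin n) ℂ) *ᵥ w ∈ W) →
      ∀ v ∈ V, (a : Matrix (Fin n) (Fin n) ℂ) *ᵥ v ∈ V) : V = W := by
  by_cases hVW : V ≤ W
  · refine le_antisymm hVW fun v hv => ?_
    obtain ⟨x, hx, hx0⟩ := (Submodule.ne_bot_iff V).1 hV
    by_cases hxv : x ∈ Submodule.span ℂ {v}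
    · obtain ⟨c, rfl⟩ := Submodule.mem_span_singleton.1 hxv
      have hc : c ≠ 0 := fun hc => hx0 (by rw [hc, zero_smul])
      exact (Submodule.smul_mem_iff V hc).1 hx
    · obtain ⟨φ, hφ, hker⟩ := Submodule.exists_le_ker_of_notMem hxv
      have hφv : φ v = 0 := hker (Submodule.mem_span_singleton_self v)
      obtain ⟨a, ha⟩ := exists_transvection φ hφv
      have h1 := h a (fun w hw => by
        rw [ha]; exact W.add_mem hw (W.smul_mem _ hv)) x hx
      rw [ha, V.add_mem_iff_right hx] at h1
      exact (Submodule.smul_mem_iff V hφ).1 h1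
  · exfalso
    obtain ⟨x, hx, hxW⟩ := Set.not_subset.1 hVW
    obtain ⟨φ, hφ, hker⟩ := Submodule.exists_le_ker_of_notMem hxW
    have hkerV : ∀ v, φ v = 0 → v ∈ V := fun v hv => by
      obtain ⟨a, ha⟩ := exists_transvection φ hv
      have h1 := h a (fun w hw => by
        rw [ha, show φ w = 0 from hker hw, zero_smul, add_zero]; exact hw) x hx
      rw [ha, V.add_mem_iff_right hx] at h1
      exact (Submodule.smul_mem_iff V hφ).1 h1
    refine hV' (eq_top_iff.2 fun y _ => ?_)
    have h2 : y - (φ y / φ x) • x ∈ V := hkerV _ (by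
      rw [map_sub, map_smul, smul_eq_mul, div_mul_cancel₀ _ hφ, sub_self])
    have := V.add_mem h2 (V.smul_mem (φ y / φ x) hx)
    rwa [sub_add_cancel] at this

theorem map_toLin'_eq_iff {n : ℕ} (W : Submodule ℂ (Fin n → ℂ)) (a : SLn n) :
    W.map (Matrix.toLin' (a : Matrix (Fin n) (Fin n) ℂ)) = W ↔
      ∀ w ∈ W, (a : Matrix (Fin n) (Fin n) ℂ) *ᵥ w ∈ W := by
  constructor
  · intro h w hw
    rw [← h]
    exact ⟨w, hw, rfl⟩
  · intro h
    have hinj : Function.Injective (Matrix.toLin' (a : Matrix (Fin n) (Fin n) ℂ)) := by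
      intro x y hxy
      have h1 : (a : Matrix (Fin n) (Fin n) ℂ) *ᵥ x = (a : Matrix (Fin n) (Fin n) ℂ) *ᵥ y := hxy
      have h2 := congrArg (fun z => ((a⁻¹ : SLn n) : Matrix (Fin n) (Fin n) ℂ) *ᵥ z) h1
      simpa only [Matrix.mulVec_mulVec, coe_inv_mul_coe, Matrix.one_mulVec] using h2
    refine Submodule.eq_of_le_of_finrank_eq ?_ (Submodule.equivMapOfInjective _ hinj W).symm.finrank_eq
    rintro _ ⟨w, hw, rfl⟩
    exact h w hw

/-- The span of the columns `g eᵢ` with `p i`. -/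
def colSpan {n : ℕ} (g : SLn n) (p : Fin n → Prop) : Submodule ℂ (Fin n → ℂ) where
  carrier := {w | ∀ i, ¬ p i → (((g⁻¹ : SLn n) : Matrix (Fin n) (Fin n) ℂ) *ᵥ w) i = 0}
  add_mem' {a b} ha hb i hi := by
    rw [Matrix.mulVec_add, Pi.add_apply, ha i hi, hb i hi, add_zero]
  zero_mem' i _ := by rw [Matrix.mulVec_zero, Pi.zero_apply]
  smul_mem' c a ha i hi := by
    rw [Matrix.mulVec_smul, Pi.smul_apply, ha i hi, smul_zero]

theorem mem_colSpan {n : ℕ} {g : SLn n} {p : Fin n → Prop} {w : Fin n → ℂ} : w ∈ colSpan g p ↔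
    ∀ i, ¬ p i → (((g⁻¹ : SLn n) : Matrix (Fin n) (Fin n) ℂ) *ᵥ w) i = 0 := Iff.rfl

theorem mulVec_mem_colSpan {n : ℕ} {g : SLn n} {p : Fin n → Prop} {x : Fin n → ℂ} :
    (g : Matrix (Fin n) (Fin n) ℂ) *ᵥ x ∈ colSpan g p ↔ ∀ i, ¬ p i → x i = 0 := by
  rw [mem_colSpan, Matrix.mulVec_mulVec, coe_inv_mul_coe, Matrix.one_mulVec]

theorem mulVec_single_mem_colSpan {n : ℕ} {g : SLn n} {p : Fin n → Prop} {j : Fin n} :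
    (g : Matrix (Fin n) (Fin n) ℂ) *ᵥ Pi.single j 1 ∈ colSpan g p ↔ p j := by
  rw [mulVec_mem_colSpan]
  constructor
  · intro h
    by_contra hj
    have := h j hj
    rw [Pi.single_eq_same] at this
    exact one_ne_zero this
  · intro hj i hi
    rw [Pi.single_eq_of_ne]
    rintro rfl
    exact hi hj

theorem map_colSpan_eq_iff {n : ℕ} (g : SLn n) (p : Fin n → Prop) (a : SLn n) :
    (colSpan g p).map (Matrix.toLin' (a : Matrix (Fin n) (Fin n) ℂ)) = colSpan g p ↔
      ∀ i j, ¬ p i → p j → ((g⁻¹ * a * g : SLn n) : Matrix (Fin n) (Fin n) ℂ) i j = 0 := by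
  rw [map_toLin'_eq_iff]
  constructor
  · intro h i j hi hj
    have h1 := mem_colSpan.1 (h _ (mulVec_single_mem_colSpan.2 hj)) i hi
    rw [Matrix.mulVec_mulVec, Matrix.mulVec_mulVec] at h1
    rw [Matrix.SpecialLinearGroup.coe_mul, Matrix.SpecialLinearGroup.coe_mul,
      ← h1, Matrix.mulVec_single_one]
    rfl
  · intro h w hw i hi
    have h1 : w = (g : Matrix (Fin n) (Fin n) ℂ) *ᵥ
        (((g⁻¹ : SLn n) : Matrix (Fin n) (Fin n) ℂ) *ᵥ w) := by
      rw [Matrix.mulVec_mulVec, coe_mul_coe_inv, Matrix.one_mulVec]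
    rw [h1, Matrix.mulVec_mulVec, Matrix.mulVec_mulVec, ← Matrix.SpecialLinearGroup.coe_mul,
      ← Matrix.SpecialLinearGroup.coe_mul, Matrix.mulVec, dotProduct]
    refine Finset.sum_eq_zero fun j _ => ?_
    by_cases hj : p j
    · rw [h i j hi hj, zero_mul]
    · rw [mem_colSpan.1 hw j hj, mul_zero]

/-- If the stabilizer of the end point of `g exp(t Λ) u` is the stabilizer of `W`, then `Λ` has
exactly two eigenvalues, and `W` is the sum of eigenspaces for the larger one. -/
theorem eq_colSpan_of_stabilizer {n : ℕ} {g : SLn n} {Λ : Fin n → ℝ}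
    {W : Submodule ℂ (Fin n → ℂ)} (hΛ : ∃ i j, Λ i < Λ j)
    (h : ∀ a : SLn n,
      (∀ i j, Λ i < Λ j → ((g⁻¹ * a * g : SLn n) : Matrix (Fin n) (Fin n) ℂ) i j = 0) ↔
        W.map (Matrix.toLin' (a : Matrix (Fin n) (Fin n) ℂ)) = W) :
    W = colSpan g (fun i => ∃ j, Λ j < Λ i) ∧
      (∀ i i', (∃ j, Λ j < Λ i) → (∃ j, Λ j < Λ i') → Λ i = Λ i') := by
  -- For each non-minimal value, the columns with `Λ` at least that value span a proper nonzero
  -- subspace preserved by the stabilizer of W. It must be W, so two different non-minimal values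
  -- cannot occur.
  have key : ∀ i, (∃ j, Λ j < Λ i) → W = colSpan g (fun l => Λ i ≤ Λ l) := by
    rintro i ⟨j, hij⟩
    symm
    refine eq_of_invariant ?_ ?_ ?_
    · intro hbot
      have h1 : (g : Matrix (Fin n) (Fin n) ℂ) *ᵥ Pi.single i 1 ∈
          colSpan g (fun l => Λ i ≤ Λ l) := mulVec_single_mem_colSpan.2 le_rfl
      rw [hbot, Submodule.mem_bot] at h1
      have h2 : (g : Matrix (Fin n) (Fin n) ℂ) *ᵥ Pi.single i 1 ∈ colSpan g (fun _ => False) := by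
        rw [h1]; exact Submodule.zero_mem _
      exact mulVec_single_mem_colSpan.1 h2
    · intro htop
      have h1 : (g : Matrix (Fin n) (Fin n) ℂ) *ᵥ Pi.single j 1 ∈
          colSpan g (fun l => Λ i ≤ Λ l) := by rw [htop]; exact Submodule.mem_top
      exact absurd (mulVec_single_mem_colSpan.1 h1) (not_le.2 hij)
    · intro a ha
      rw [← map_toLin'_eq_iff] at ha ⊢
      rw [map_colSpan_eq_iff]
      intro l m hl hm
      exact (h a).2 ha l m (lt_of_lt_of_le (not_le.1 hl) hm)
  have hle : ∀ i i', (∃ j, Λ j < Λ i) → (∃ j, Λ j < Λ i') → Λ i ≤ Λ i' := by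
    intro i i' hi hi'
    have h1 : (g : Matrix (Fin n) (Fin n) ℂ) *ᵥ Pi.single i' 1 ∈
        colSpan g (fun l => Λ i ≤ Λ l) := by
      rw [← key i hi, key i' hi']
      exact mulVec_single_mem_colSpan.2 le_rfl
    exact mulVec_single_mem_colSpan.1 h1
  refine ⟨?_, fun i i' hi hi' => le_antisymm (hle i i' hi hi') (hle i' i hi' hi)⟩
  obtain ⟨j, i, hij⟩ := hΛ
  rw [key i ⟨j, hij⟩]
  congr 1
  ext l
  exact ⟨fun hl => ⟨j, hij.trans_le hl⟩, fun hl => hle i l ⟨j, hij⟩ hl⟩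

/-! ### Hermitian metrics and frames -/

theorem HermitianMetric.exists_orthonormal_basis {V : Type} [AddCommGroup V] [Module ℂ V]
    [FiniteDimensional ℂ V] (h : HermitianMetric V) :
    ∃ b : Module.Basis (Fin (Module.finrank ℂ V)) ℂ V,
      ∀ i j, h.form (b i) (b j) = if i = j then 1 else 0 := by
  let core : InnerProductSpace.Core ℂ V :=
    { inner := fun x y => h.form x y
      conj_inner_symm := fun x y => h.conj_symm y x
      re_inner_nonneg := fun x => by
        by_cases hx : x = 0
        · rw [hx]; simp
        · exact (h.pos x hx).le
      add_left := fun x y z => by rw [map_add, LinearMap.add_apply]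
      smul_left := fun x y c => by rw [LinearMap.map_smulₛₗ, LinearMap.smul_apply, smul_eq_mul]
      definite := fun x hx => by
        by_contra hx0
        have := h.pos x hx0
        rw [hx] at this
        exact lt_irrefl _ this }
  let : NormedAddCommGroup V := core.toNormedAddCommGroup
  let : InnerProductSpace ℂ V := InnerProductSpace.ofCore core.toCore
  refine ⟨(stdOrthonormalBasis ℂ V).toBasis, fun i j => ?_⟩
  rw [OrthonormalBasis.coe_toBasis]
  exact orthonormal_iff_ite.1 (stdOrthonormalBasis ℂ V).orthonormal i j

/-- A positive multiple of a hermitian metric. -/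
def HermitianMetric.scale {V : Type} [AddCommGroup V] [Module ℂ V] (h : HermitianMetric V)
    {c : ℝ} (hc : 0 < c) : HermitianMetric V where
  form := (c : ℂ) • h.form
  conj_symm x y := by
    rw [LinearMap.smul_apply, LinearMap.smul_apply, LinearMap.smul_apply, LinearMap.smul_apply,
      smul_eq_mul, smul_eq_mul, map_mul, Complex.conj_ofReal, h.conj_symm]
  pos x hx := by
    rw [LinearMap.smul_apply, LinearMap.smul_apply, smul_eq_mul, Complex.re_ofReal_mul]
    exact mul_pos hc (h.pos x hx)

/-- The hermitian metric on `W` obtained by pulling back the standard one along `g⁻¹`. -/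
def pullbackMetric {n : ℕ} (g : SLn n) (W : Submodule ℂ (Fin n → ℂ)) : HermitianMetric W where
  form := LinearMap.mk₂'ₛₗ (starRingEnd ℂ) (RingHom.id ℂ)
    (fun w w' => star (((g⁻¹ : SLn n) : Matrix (Fin n) (Fin n) ℂ) *ᵥ (w : Fin n → ℂ)) ⬝ᵥ
      (((g⁻¹ : SLn n) : Matrix (Fin n) (Fin n) ℂ) *ᵥ (w' : Fin n → ℂ)))
    (fun x y z => by rw [Submodule.coe_add, Matrix.mulVec_add, star_add, add_dotProduct])
    (fun c x y => by
      rw [Submodule.coe_smul, Matrix.mulVec_smul, star_smul, smul_dotProduct, RCLike.star_def])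
    (fun x y z => by rw [Submodule.coe_add, Matrix.mulVec_add, dotProduct_add])
    (fun c x y => by
      rw [Submodule.coe_smul, Matrix.mulVec_smul, dotProduct_smul, RingHom.id_apply])
  conj_symm x y := by
    simp only [LinearMap.mk₂'ₛₗ_apply]
    rw [← RCLike.star_def, ← Matrix.star_dotProduct_star, star_star]
  pos x hx := by
    simp only [LinearMap.mk₂'ₛₗ_apply]
    have hne : ((g⁻¹ : SLn n) : Matrix (Fin n) (Fin n) ℂ) *ᵥ (x : Fin n → ℂ) ≠ 0 := by
      intro h0
      have h1 := congrArg (fun z => (g : Matrix (Fin n) (Fin n) ℂ) *ᵥ z) h0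
      simp only [Matrix.mulVec_mulVec, coe_mul_coe_inv, Matrix.one_mulVec, Matrix.mulVec_zero] at h1
      exact hx (Subtype.ext h1)
    exact (Complex.pos_iff.1 (Matrix.dotProduct_star_self_pos_iff.2 hne)).1

/-- The columns `g eᵢ` with `p i` are an orthonormal basis of `W` with respect to `h`. -/
def IsFrame {n : ℕ} {W : Submodule ℂ (Fin n → ℂ)} (h : HermitianMetric W) (g : SLn n)
    (p : Fin n → Prop) : Prop :=
  W = colSpan g p ∧ ∀ w w' : W, h.form w w' =
    star (((g⁻¹ : SLn n) : Matrix (Fin n) (Fin n) ℂ) *ᵥ (w : Fin n → ℂ)) ⬝ᵥ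
      (((g⁻¹ : SLn n) : Matrix (Fin n) (Fin n) ℂ) *ᵥ (w' : Fin n → ℂ))

theorem isFrame_pullbackMetric {n : ℕ} {g : SLn n} {p : Fin n → Prop}
    {W : Submodule ℂ (Fin n → ℂ)} (hW : W = colSpan g p) : IsFrame (pullbackMetric g W) g p :=
  ⟨hW, fun _ _ => rfl⟩

/-- The basis `g eᵢ`, `p i`, of `colSpan g p`. -/
theorem exists_basis_colSpan {n : ℕ} (g : SLn n) (p : Fin n → Prop) :
    ∃ b : Module.Basis {i // p i} ℂ (colSpan g p),
      ∀ i, (b i : Fin n → ℂ) = (g : Matrix (Fin n) (Fin n) ℂ) *ᵥ Pi.single i.1 1 := by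
  classical
  let f : colSpan g p ≃ₗ[ℂ] ({i // p i} → ℂ) :=
    { toFun := fun w i => (((g⁻¹ : SLn n) : Matrix (Fin n) (Fin n) ℂ) *ᵥ (w : Fin n → ℂ)) i
      map_add' := fun x y => by ext i; simp [Matrix.mulVec_add]
      map_smul' := fun c x => by ext i; simp [Matrix.mulVec_smul]
      invFun := fun x => ⟨(g : Matrix (Fin n) (Fin n) ℂ) *ᵥ
        fun i => if hi : p i then x ⟨i, hi⟩ else 0,
        mulVec_mem_colSpan.2 fun i hi => dif_neg hi⟩
      left_inv := fun w => by
        apply Subtype.ext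
        have h1 : (fun i => if p i then
            (((g⁻¹ : SLn n) : Matrix (Fin n) (Fin n) ℂ) *ᵥ (w : Fin n → ℂ)) i else 0) =
            ((g⁻¹ : SLn n) : Matrix (Fin n) (Fin n) ℂ) *ᵥ (w : Fin n → ℂ) := by
          ext i
          split_ifs with hi
          · rfl
          · exact (mem_colSpan.1 w.2 i hi).symm
        change (g : Matrix (Fin n) (Fin n) ℂ) *ᵥ (fun i => if p i then
            (((g⁻¹ : SLn n) : Matrix (Fin n) (Fin n) ℂ) *ᵥ (w : Fin n → ℂ)) i else 0) = w
        rw [h1, Matrix.mulVec_mulVec, coe_mul_coe_inv, Matrix.one_mulVec]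
      right_inv := fun x => by
        ext i
        simp only [Matrix.mulVec_mulVec, coe_inv_mul_coe, Matrix.one_mulVec]
        exact dif_pos i.2 }
  refine ⟨Module.Basis.ofEquivFun f, fun i => ?_⟩
  have h1 : Module.Basis.ofEquivFun f i = f.symm (Pi.single i 1) := by
    rw [Module.Basis.coe_ofEquivFun]
  rw [h1]
  change (g : Matrix (Fin n) (Fin n) ℂ) *ᵥ (fun j => if hj : p j then
    (Pi.single i 1 : {i // p i} → ℂ) ⟨j, hj⟩ else 0) = _
  congr 1
  ext j
  simp only [Pi.single_apply, Subtype.ext_iff]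
  split_ifs with h1 h2 h2 <;> first | rfl | skip
  exact absurd (h2 ▸ i.2) h1

theorem finrank_colSpan {n : ℕ} (g : SLn n) (p : Fin n → Prop) [DecidablePred p] :
    Module.finrank ℂ (colSpan g p) = Fintype.card {i // p i} := by
  obtain ⟨b, -⟩ := exists_basis_colSpan g p
  exact Module.finrank_eq_card_basis b

/-- This replaces orthonormal bases by a coordinate formula for the form, so that later arguments
can be carried out with matrices. -/
theorem isFrame_iff {n : ℕ} {W : Submodule ℂ (Fin n → ℂ)} (h : HermitianMetric W) (g : SLn n)
    (p : Fin n → Prop) : IsFrame h g p ↔ ∃ b : Module.Basis {i // p i} ℂ W,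
      (∀ i, (b i : Fin n → ℂ) = (g : Matrix (Fin n) (Fin n) ℂ) *ᵥ Pi.single i.1 1) ∧
        ∀ i j, h.form (b i) (b j) = if i = j then 1 else 0 := by
  classical
  constructor
  · rintro ⟨rfl, hform⟩
    obtain ⟨b, hb⟩ := exists_basis_colSpan g p
    refine ⟨b, hb, fun i j => ?_⟩
    rw [hform, hb, hb, Matrix.mulVec_mulVec, Matrix.mulVec_mulVec, coe_inv_mul_coe,
      Matrix.one_mulVec, Matrix.one_mulVec, dotProduct_single, mul_one, Pi.star_apply,
      Pi.single_apply]
    simp only [Subtype.ext_iff, eq_comm]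
    split_ifs <;> simp
  · rintro ⟨b, hb, hform⟩
    have hW : W = colSpan g p := by
      apply le_antisymm
      · intro w hw
        have h1 := congrArg (Submodule.subtype W) (b.sum_repr ⟨w, hw⟩)
        rw [map_sum] at h1
        change _ = w at h1
        rw [← h1]
        refine Submodule.sum_mem _ fun i _ => ?_
        rw [map_smul, Submodule.subtype_apply, hb]
        exact Submodule.smul_mem _ _ (mulVec_single_mem_colSpan.2 i.2)
      · obtain ⟨b', hb'⟩ := exists_basis_colSpan g p
        intro w hw
        have h1 := congrArg (Submodule.subtype _) (b'.sum_repr ⟨w, hw⟩)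
        rw [map_sum] at h1
        change _ = w at h1
        rw [← h1]
        refine Submodule.sum_mem _ fun i _ => ?_
        rw [map_smul, Submodule.subtype_apply, hb', ← hb]
        exact Submodule.smul_mem _ _ (b i).2
    refine ⟨hW, fun w w' => ?_⟩
    have heq : h.form = (pullbackMetric g W).form := by
      refine b.ext fun i => b.ext fun j => ?_
      rw [hform]
      change _ = star (((g⁻¹ : SLn n) : Matrix (Fin n) (Fin n) ℂ) *ᵥ (b i : Fin n → ℂ)) ⬝ᵥ
        (((g⁻¹ : SLn n) : Matrix (Fin n) (Fin n) ℂ) *ᵥ (b j : Fin n → ℂ))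
      rw [hb, hb, Matrix.mulVec_mulVec, Matrix.mulVec_mulVec, coe_inv_mul_coe,
        Matrix.one_mulVec, Matrix.one_mulVec, dotProduct_single, mul_one, Pi.star_apply,
        Pi.single_apply]
      simp only [Subtype.ext_iff, eq_comm]
      split_ifs <;> simp
    rw [heq]
    rfl

theorem isOrthonormalBasisOf_iff {n : ℕ} {W : Submodule ℂ (Fin n → ℂ)} (c : MetricClass W)
    (g : SLn n) (p : Fin n → Prop) :
    IsOrthonormalBasisOf c (fun i : {i // p i} =>
      (g : Matrix (Fin n) (Fin n) ℂ) *ᵥ Pi.single i.1 1) ↔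
    ∃ h : HermitianMetric W, Quotient.mk (homothetySetoid W) h = c ∧ IsFrame h g p :=
  exists_congr fun h => and_congr Iff.rfl (isFrame_iff h g p).symm

/-! ### The hermitian matrix attached to a frame -/

/-- The sum of `(g eᵢ)(g eᵢ)ᴴ` over the `i` with `p i`. -/
def frameGram {n : ℕ} (g : SLn n) (p : Fin n → Prop) [DecidablePred p] :
    Matrix (Fin n) (Fin n) ℂ :=
  (g : Matrix (Fin n) (Fin n) ℂ) * Matrix.diagonal (fun i => if p i then 1 else 0) *
    (g : Matrix (Fin n) (Fin n) ℂ)ᴴ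

theorem frameGram_mulVec_mem {n : ℕ} (g : SLn n) (p : Fin n → Prop) [DecidablePred p]
    (x : Fin n → ℂ) : frameGram g p *ᵥ x ∈ colSpan g p := by
  rw [frameGram, Matrix.mul_assoc, ← Matrix.mulVec_mulVec, mulVec_mem_colSpan]
  intro i hi
  rw [← Matrix.mulVec_mulVec, Matrix.mulVec_diagonal, if_neg hi, zero_mul]

theorem exists_frameGram_mulVec_eq {n : ℕ} {g : SLn n} {p : Fin n → Prop} [DecidablePred p]
    {w : Fin n → ℂ} (hw : w ∈ colSpan g p) : ∃ x, frameGram g p *ᵥ x = w := by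
  have h1 := congrArg Matrix.conjTranspose (coe_inv_mul_coe g)
  rw [Matrix.conjTranspose_mul, Matrix.conjTranspose_one] at h1
  refine ⟨((g⁻¹ : SLn n) : Matrix (Fin n) (Fin n) ℂ)ᴴ *ᵥ
    (((g⁻¹ : SLn n) : Matrix (Fin n) (Fin n) ℂ) *ᵥ w), ?_⟩
  rw [frameGram, Matrix.mulVec_mulVec, Matrix.mul_assoc, h1, Matrix.mul_one,
    ← Matrix.mulVec_mulVec]
  have h2 : Matrix.diagonal (fun i => if p i then (1 : ℂ) else 0) *ᵥ
      (((g⁻¹ : SLn n) : Matrix (Fin n) (Fin n) ℂ) *ᵥ w) =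
      ((g⁻¹ : SLn n) : Matrix (Fin n) (Fin n) ℂ) *ᵥ w := by
    ext i
    rw [Matrix.mulVec_diagonal]
    split_ifs with hi
    · rw [one_mul]
    · rw [mem_colSpan.1 hw i hi, mul_zero]
  rw [h2, Matrix.mulVec_mulVec, coe_mul_coe_inv, Matrix.one_mulVec]

theorem IsFrame.frameGram_mulVec_mem {n : ℕ} {W : Submodule ℂ (Fin n → ℂ)} {h : HermitianMetric W}
    {g : SLn n} {p : Fin n → Prop} [DecidablePred p] (hf : IsFrame h g p) (x : Fin n → ℂ) :
    frameGram g p *ᵥ x ∈ W := by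
  rw [hf.1]
  exact SLSym.frameGram_mulVec_mem g p x

/-- `frameGram` is the inverse of the metric: this identity characterizes `frameGram g p *ᵥ x` as
the vector of W representing the standard pairing with `x`. So the matrix depends on `h` alone, not
on the frame. -/
theorem IsFrame.form_frameGram_mulVec {n : ℕ} {W : Submodule ℂ (Fin n → ℂ)}
    {h : HermitianMetric W} {g : SLn n} {p : Fin n → Prop} [DecidablePred p]
    (hf : IsFrame h g p) (x : Fin n → ℂ) (w : W) :
    h.form ⟨frameGram g p *ᵥ x, hf.frameGram_mulVec_mem x⟩ w = star x ⬝ᵥ (w : Fin n → ℂ) := by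
  have hw : (w : Fin n → ℂ) ∈ colSpan g p := hf.1 ▸ w.2
  have h2 : Matrix.diagonal (fun i => if p i then (1 : ℂ) else 0) *ᵥ
      (((g⁻¹ : SLn n) : Matrix (Fin n) (Fin n) ℂ) *ᵥ (w : Fin n → ℂ)) =
      ((g⁻¹ : SLn n) : Matrix (Fin n) (Fin n) ℂ) *ᵥ (w : Fin n → ℂ) := by
    ext i
    rw [Matrix.mulVec_diagonal]
    split_ifs with hi
    · rw [one_mul]
    · rw [mem_colSpan.1 hw i hi, mul_zero]
  have hD : (Matrix.diagonal (fun i => if p i then (1 : ℂ) else 0))ᴴ =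
      Matrix.diagonal (fun i => if p i then (1 : ℂ) else 0) := by
    rw [Matrix.diagonal_conjTranspose]
    congr 1
    ext i
    rw [Pi.star_apply]
    split_ifs <;> simp
  rw [hf.2]
  change star (((g⁻¹ : SLn n) : Matrix (Fin n) (Fin n) ℂ) *ᵥ (frameGram g p *ᵥ x)) ⬝ᵥ
    (((g⁻¹ : SLn n) : Matrix (Fin n) (Fin n) ℂ) *ᵥ (w : Fin n → ℂ)) = _
  rw [frameGram, Matrix.mulVec_mulVec, Matrix.mul_assoc, ← Matrix.mul_assoc,
    coe_inv_mul_coe, Matrix.one_mul, Matrix.star_mulVec, Matrix.conjTranspose_mul, hD,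
    Matrix.conjTranspose_conjTranspose, ← Matrix.dotProduct_mulVec, ← Matrix.mulVec_mulVec, h2,
    Matrix.mulVec_mulVec, coe_mul_coe_inv, Matrix.one_mulVec]

/-- Multiplying the metric by `c` multiplies its inverse by `c⁻¹`. Positivity of `h` gives the
uniqueness. -/
theorem IsFrame.frameGram_eq_smul {n : ℕ} {W : Submodule ℂ (Fin n → ℂ)}
    {h h₁ : HermitianMetric W} {g g₁ : SLn n} {p p₁ : Fin n → Prop} [DecidablePred p]
    [DecidablePred p₁] (hf : IsFrame h g p) (hf₁ : IsFrame h₁ g₁ p₁) {c : ℝ} (hc : 0 < c)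
    (hh : ∀ x y, h₁.form x y = (c : ℂ) * h.form x y) :
    frameGram g₁ p₁ = ((c⁻¹ : ℝ) : ℂ) • frameGram g p := by
  refine Matrix.ext_iff_mulVec.2 fun x => ?_
  have hc0 : (c : ℂ) ≠ 0 := by exact_mod_cast hc.ne'
  set u : W := ⟨frameGram g₁ p₁ *ᵥ x, hf₁.frameGram_mulVec_mem x⟩
  set v : W := ⟨frameGram g p *ᵥ x, hf.frameGram_mulVec_mem x⟩
  have h1 : ∀ w, h.form (u - ((c⁻¹ : ℝ) : ℂ) • v) w = 0 := fun w => by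
    have e1 := hh u w
    rw [hf₁.form_frameGram_mulVec] at e1
    have e2 := hf.form_frameGram_mulVec x w
    rw [map_sub, LinearMap.sub_apply, LinearMap.map_smulₛₗ, LinearMap.smul_apply, e2,
      Complex.conj_ofReal, e1, smul_eq_mul]
    push_cast
    field_simp
    ring
  have h2 : u - ((c⁻¹ : ℝ) : ℂ) • v = 0 := by
    by_contra hne
    have := h.pos _ hne
    rw [h1] at this
    exact lt_irrefl _ this
  have h3 := congrArg (Submodule.subtype W) (sub_eq_zero.1 h2)
  rw [Matrix.smul_mulVec]
  exact h3

/-- The converse direction: every `x ∈ W` is in the image of `frameGram`, so the characterizing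
identity recovers the whole form. -/
theorem IsFrame.form_eq_of_frameGram_eq_smul {n : ℕ} {W : Submodule ℂ (Fin n → ℂ)}
    {h h₁ : HermitianMetric W} {g g₁ : SLn n} {p p₁ : Fin n → Prop} [DecidablePred p]
    [DecidablePred p₁] (hf : IsFrame h g p) (hf₁ : IsFrame h₁ g₁ p₁) {c : ℝ}
    (hP : frameGram g p = (c : ℂ) • frameGram g₁ p₁) (x y : W) :
    h₁.form x y = (c : ℂ) * h.form x y := by
  obtain ⟨z, hz⟩ := exists_frameGram_mulVec_eq (g := g) (p := p) (w := x) (hf.1 ▸ x.2)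
  have hx : x = ⟨frameGram g p *ᵥ z, hf.frameGram_mulVec_mem z⟩ := Subtype.ext hz.symm
  have hx₁ : x = (c : ℂ) • ⟨frameGram g₁ p₁ *ᵥ z, hf₁.frameGram_mulVec_mem z⟩ := by
    apply Subtype.ext
    rw [← hz, hP, Matrix.smul_mulVec]
    rfl
  have e1 : h.form x y = star z ⬝ᵥ (y : Fin n → ℂ) := by
    rw [hx]
    exact hf.form_frameGram_mulVec z y
  rw [e1, hx₁, LinearMap.map_smulₛₗ, LinearMap.smul_apply, hf₁.form_frameGram_mulVec,
    Complex.conj_ofReal, smul_eq_mul]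

/-! ### Comparison of two-valued geodesics -/

theorem smul_frameGram_add {n : ℕ} (g : SLn n) (p : Fin n → Prop) [DecidablePred p] (α β : ℂ) :
    α • frameGram g p + β • frameGram g (fun i => ¬ p i) =
      (g : Matrix (Fin n) (Fin n) ℂ) * Matrix.diagonal (fun i => if p i then α else β) *
        (g : Matrix (Fin n) (Fin n) ℂ)ᴴ := by
  ext i j
  simp only [frameGram, Matrix.add_apply, Matrix.smul_apply, Matrix.mul_apply (M := _ * _),
    Matrix.mul_diagonal, smul_eq_mul, Finset.mul_sum, ← Finset.sum_add_distrib]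
  refine Finset.sum_congr rfl fun k _ => ?_
  by_cases hk : p k
  · simp only [hk, if_true, not_true_eq_false, if_false]
    ring
  · simp only [hk, if_true, not_false_eq_true, if_false]
    ring

theorem gram_eq_frameGram {n : ℕ} (g : SLn n) {p : Fin n → Prop} [DecidablePred p]
    {Λ : traceZero n} {x y : ℝ} (hΛ : ∀ i, Λ.1 i = if p i then x else y) (t : ℝ) :
    ((g * diagExp (t • Λ) : SLn n) : Matrix (Fin n) (Fin n) ℂ) *
        ((g * diagExp (t • Λ) : SLn n) : Matrix (Fin n) (Fin n) ℂ)ᴴ =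
      (Real.exp (2 * (t * x)) : ℂ) • frameGram g p +
        (Real.exp (2 * (t * y)) : ℂ) • frameGram g (fun i => ¬ p i) := by
  rw [gram_mul_diagExp, smul_frameGram_add]
  congr 3
  ext i
  change (Real.exp (2 * (t * Λ.1 i)) : ℂ) = _
  rw [hΛ]
  split_ifs <;> rfl

/-- Frames with proportional gram matrices define the same curve up to a shift. -/
theorem exists_shift {n : ℕ} {g g₁ : SLn n} {p p₁ : Fin n → Prop} [DecidablePred p]
    [DecidablePred p₁] {Λ Λ₁ : traceZero n} {x y α β : ℝ} (hx : x ≠ 0) (hp : ∃ i, p i)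
    (hΛ : ∀ i, Λ.1 i = if p i then x else y) (hΛ₁ : ∀ i, Λ₁.1 i = if p₁ i then x else y)
    (hα : 0 < α) (hβ : 0 < β) (hP : frameGram g₁ p₁ = (α : ℂ) • frameGram g p)
    (hP' : frameGram g₁ (fun i => ¬ p₁ i) = (β : ℂ) • frameGram g (fun i => ¬ p i)) :
    ∃ s : ℝ, ∀ t : ℝ, tau (g₁ * diagExp (t • Λ₁)) = tau (g * diagExp ((t + s) • Λ)) := by
  have hsum : ∑ i, (if p i then x else y) = 0 := by
    have h : ∑ i, Λ.1 i = 0 := Λ.2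
    simpa only [hΛ] using h
  -- Comparing determinants at `t = 0`, where both are one, gives that `α` and `β`, raised to the
  -- multiplicities of the two values, have product one.
  have hlog : ∑ i, (if p i then Real.log α else Real.log β) = 0 := by
    have h1 := gram_eq_frameGram g₁ hΛ₁ 0
    rw [zero_smul, diagExp_zero, mul_one, zero_mul, zero_mul, mul_zero, Real.exp_zero,
      Complex.ofReal_one, one_smul, one_smul, hP, hP', smul_frameGram_add] at h1
    have h2 := congrArg Matrix.det h1
    simp only [Matrix.det_mul, Matrix.det_conjTranspose, Matrix.SpecialLinearGroup.det_coe,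
      Matrix.det_diagonal, star_one, one_mul, mul_one] at h2
    have h3 : ∏ i, (if p i then α else β) = 1 := by
      apply Complex.ofReal_injective
      rw [Complex.ofReal_prod, Complex.ofReal_one, h2]
      refine Finset.prod_congr rfl fun i _ => ?_
      split_ifs <;> rfl
    have h4 := congrArg Real.log h3
    rw [Real.log_one, Real.log_prod fun i _ => by split_ifs <;> positivity] at h4
    rw [← h4]
    refine Finset.sum_congr rfl fun i _ => ?_
    split_ifs <;> rfl
  rw [Finset.sum_ite, Finset.sum_const, Finset.sum_const, nsmul_eq_mul, nsmul_eq_mul] at hsum hlog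
  have hcard : ((Finset.univ.filter fun i => p i).card : ℝ) ≠ 0 := by
    obtain ⟨i, hi⟩ := hp
    exact_mod_cast (Finset.card_pos.2 ⟨i, by simpa using hi⟩).ne'
  set a : ℝ := ((Finset.univ.filter fun i => p i).card : ℝ)
  set b : ℝ := ((Finset.univ.filter fun i => ¬ p i).card : ℝ)
  -- The pairs `(x, y)` and `(log α, log β)` satisfy the same linear equation, so they are
  -- proportional. The shift `log α / (2x)` then produces the factor `α` and the factor `β` at once.
  have hxy : x * Real.log β = y * Real.log α := by
    refine mul_left_cancel₀ hcard ?_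
    linear_combination Real.log β * hsum - y * hlog
  refine ⟨Real.log α / (2 * x), fun t => ?_⟩
  have e1 : 2 * ((t + Real.log α / (2 * x)) * x) = 2 * (t * x) + Real.log α := by field_simp
  have e2 : 2 * ((t + Real.log α / (2 * x)) * y) = 2 * (t * y) + Real.log β := by
    field_simp
    linear_combination -hxy
  rw [tau_eq_iff, gram_eq_frameGram g₁ hΛ₁, gram_eq_frameGram g hΛ, e1, e2, Real.exp_add,
    Real.exp_add, Real.exp_log hα, Real.exp_log hβ, hP, hP', smul_smul, smul_smul]
  push_cast
  rfl

/-- Curves through a common point have proportional gram matrices. -/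
theorem exists_frameGram_eq_smul {n : ℕ} {W W' : Submodule ℂ (Fin n → ℂ)} (hWW' : IsCompl W W')
    {g g₁ : SLn n} {p p₁ : Fin n → Prop} [DecidablePred p] [DecidablePred p₁]
    {Λ Λ₁ : traceZero n} {x y : ℝ}
    (hΛ : ∀ i, Λ.1 i = if p i then x else y) (hΛ₁ : ∀ i, Λ₁.1 i = if p₁ i then x else y)
    (hW : W = colSpan g p) (hW' : W' = colSpan g fun i => ¬ p i)
    (hW₁ : W = colSpan g₁ p₁) (hW₁' : W' = colSpan g₁ fun i => ¬ p₁ i) {t t₁ : ℝ}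
    (h : tau (g * diagExp (t • Λ)) = tau (g₁ * diagExp (t₁ • Λ₁))) :
    ∃ α β : ℝ, 0 < α ∧ 0 < β ∧ frameGram g p = (α : ℂ) • frameGram g₁ p₁ ∧
      frameGram g (fun i => ¬ p i) = (β : ℂ) • frameGram g₁ (fun i => ¬ p₁ i) := by
  rw [tau_eq_iff, gram_eq_frameGram g hΛ, gram_eq_frameGram g₁ hΛ₁] at h
  have key : ∀ v, (Real.exp (2 * (t * x)) : ℂ) • frameGram g p *ᵥ v =
      (Real.exp (2 * (t₁ * x)) : ℂ) • frameGram g₁ p₁ *ᵥ v ∧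
      (Real.exp (2 * (t * y)) : ℂ) • frameGram g (fun i => ¬ p i) *ᵥ v =
      (Real.exp (2 * (t₁ * y)) : ℂ) • frameGram g₁ (fun i => ¬ p₁ i) *ᵥ v := by
    intro v
    have h1 := congrArg (fun A => A *ᵥ v) h
    simp only [Matrix.add_mulVec, Matrix.smul_mulVec] at h1
    have m1 : frameGram g p *ᵥ v ∈ W := by
      rw [hW]; exact frameGram_mulVec_mem g p v
    have m2 : frameGram g (fun i => ¬ p i) *ᵥ v ∈ W' := by
      rw [hW']; exact frameGram_mulVec_mem g _ v
    have m3 : frameGram g₁ p₁ *ᵥ v ∈ W := by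
      rw [hW₁]; exact frameGram_mulVec_mem g₁ p₁ v
    have m4 : frameGram g₁ (fun i => ¬ p₁ i) *ᵥ v ∈ W' := by
      rw [hW₁']; exact frameGram_mulVec_mem g₁ _ v
    -- The difference of the two W-components equals a difference of W'-components, so it lies in `W
    -- ∩ W' = 0`.
    have h2 := sub_eq_sub_iff_add_eq_add.2 (h1.trans (add_comm _ _))
    have h3 := Submodule.disjoint_def.1 hWW'.disjoint _
      (W.sub_mem (W.smul_mem _ m1) (W.smul_mem _ m3))
      (by rw [h2]; exact W'.sub_mem (W'.smul_mem _ m4) (W'.smul_mem _ m2))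
    have h4 := sub_eq_zero.1 h3
    refine ⟨h4, ?_⟩
    rw [h3] at h2
    exact (sub_eq_zero.1 h2.symm).symm
  have hdiv : ∀ {A B : Matrix (Fin n) (Fin n) ℂ} {a b : ℝ},
      (∀ v, (Real.exp a : ℂ) • A *ᵥ v = (Real.exp b : ℂ) • B *ᵥ v) →
      A = ((Real.exp (b - a) : ℝ) : ℂ) • B := by
    intro A B a b hAB
    refine Matrix.ext_iff_mulVec.2 fun v => ?_
    have hne : (Real.exp a : ℂ) ≠ 0 := by exact_mod_cast (Real.exp_pos a).ne'
    refine smul_right_injective _ hne ?_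
    change (Real.exp a : ℂ) • A *ᵥ v = (Real.exp a : ℂ) • (((Real.exp (b - a) : ℝ) : ℂ) • B) *ᵥ v
    rw [hAB v, Matrix.smul_mulVec, smul_smul, ← Complex.ofReal_mul, ← Real.exp_add,
      add_sub_cancel]
  exact ⟨_, _, Real.exp_pos _, Real.exp_pos _, hdiv fun v => (key v).1, hdiv fun v => (key v).2⟩

/-! ### Geodesics joining `z_W` and `z_{W'}` -/

theorem card_subtype_lt {n r : ℕ} (hrn : r < n) :
    Fintype.card {i : Fin n // (i : ℕ) < r} = r := by
  rw [Fintype.card_subtype, Fin.card_filter_val_lt]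
  omega

/-- The element `(ρ, …, ρ, σ, …, σ)` of the flat. -/
def rhoSigma (n r : ℕ) (hrn : r < n) : traceZero n :=
  ⟨WithLp.toLp 2 fun i => if (i : ℕ) < r then rho n r else sigma n r, by
    have h := trace_diagRhoSigma hrn
    rw [diagRhoSigma, Matrix.trace_diagonal] at h
    change ∑ i : Fin n, (if (i : ℕ) < r then rho n r else sigma n r) = 0
    apply Complex.ofReal_injective
    rw [Complex.ofReal_sum, Complex.ofReal_zero, ← h]
    refine Finset.sum_congr rfl fun i _ => ?_
    split_ifs <;> rfl⟩

theorem rhoSigma_apply {n r : ℕ} (hrn : r < n) (i : Fin n) :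
    (rhoSigma n r hrn).1 i = if (i : ℕ) < r then rho n r else sigma n r := rfl

theorem expDiag_eq_diagExp {n r : ℕ} (hrn : r < n) (t : ℝ) :
    expDiag n r hrn t = diagExp (t • rhoSigma n r hrn) := by
  apply Subtype.ext
  change NormedSpace.exp ((t : ℂ) • diagRhoSigma n r) = Matrix.diagonal fun i : Fin n =>
    (Real.exp (t * (rhoSigma n r hrn).1 i) : ℂ)
  rw [diagRhoSigma, ← Matrix.diagonal_smul, Matrix.exp_diagonal]
  congr 1
  ext i
  rw [Pi.coe_exp, ← Complex.exp_eq_exp_ℂ, Pi.smul_apply, rhoSigma_apply, Complex.ofReal_exp]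
  split_ifs <;> simp

theorem stdCurve_eq {n r : ℕ} (hrn : r < n) (g : SLn n) (t : ℝ) :
    stdCurve hrn g t = tau (g * diagExp (t • rhoSigma n r hrn)) := by
  rw [stdCurve, smul_basePoint, expDiag_eq_diagExp]

theorem rho_pos {n r : ℕ} (hr0 : 0 < r) (hrn : r < n) : 0 < rho n r := by
  have h1 : (0 : ℝ) < r := by exact_mod_cast hr0
  have h2 : (r : ℝ) < n := by exact_mod_cast hrn
  have h3 : (0 : ℝ) < n := h1.trans h2
  exact Real.sqrt_pos.2 (div_pos (sub_pos.2 h2) (by positivity))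

theorem sigma_neg {n r : ℕ} (hr0 : 0 < r) (hrn : r < n) : sigma n r < 0 := by
  have h1 : (0 : ℝ) < r := by exact_mod_cast hr0
  have h2 : (r : ℝ) < n := by exact_mod_cast hrn
  exact mul_neg_of_neg_of_pos (neg_neg_of_pos (div_pos h1 (sub_pos.2 h2))) (rho_pos hr0 hrn)

theorem sum_ite_eq_of_card {n r : ℕ} {p : Fin n → Prop} [DecidablePred p]
    (hp : Fintype.card {i // p i} = r) (x y : ℝ) :
    ∑ i, (if p i then x else y) = r * x + ((n : ℝ) - r) * y := by
  have h1 : (Finset.univ.filter fun i => p i).card = r := by rw [← hp, Fintype.card_subtype]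
  have h2 : ((Finset.univ.filter fun i => ¬ p i).card : ℝ) = n - r := by
    have := Finset.card_filter_add_card_filter_not (s := (Finset.univ : Finset (Fin n))) p
    rw [h1, Finset.card_univ, Fintype.card_fin] at this
    rw [eq_sub_iff_add_eq']
    exact_mod_cast this
  rw [Finset.sum_ite, Finset.sum_const, Finset.sum_const, nsmul_eq_mul, nsmul_eq_mul, h1, h2]

theorem sq_norm_of_two_valued {n r : ℕ} {p : Fin n → Prop} [DecidablePred p]
    (hp : Fintype.card {i // p i} = r) {Λ : traceZero n} {x y : ℝ}
    (hΛ : ∀ i, Λ.1 i = if p i then x else y) :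
    (2 * Real.sqrt n * ‖Λ‖) ^ 2 = 4 * n * (r * x ^ 2 + ((n : ℝ) - r) * y ^ 2) := by
  rw [mul_pow, mul_pow, Real.sq_sqrt (Nat.cast_nonneg n), Submodule.coe_norm,
    EuclideanSpace.norm_sq_eq, ← sum_ite_eq_of_card hp]
  have : ∀ i, ‖Λ.1 i‖ ^ 2 = if p i then x ^ 2 else y ^ 2 := fun i => by
    rw [hΛ, Real.norm_eq_abs, sq_abs]
    split_ifs <;> rfl
  simp only [this]
  ring

/-- This is the origin of the value of ρ: the squared speed is `4n(rρ² + (n - r)σ²) = 4rn²ρ² / (n -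
r)`. -/
theorem norm_rhoSigma {n r : ℕ} (hr0 : 0 < r) (hrn : r < n) :
    2 * Real.sqrt n * ‖rhoSigma n r hrn‖ = 1 := by
  have h1 : (0 : ℝ) < r := by exact_mod_cast hr0
  have h2 : (0 : ℝ) < n - r := sub_pos.2 (by exact_mod_cast hrn)
  have h3 : (0 : ℝ) < n := by linarith
  refine (pow_eq_one_iff_of_nonneg (by positivity) two_ne_zero).1 ?_
  rw [sq_norm_of_two_valued (card_subtype_lt hrn) (rhoSigma_apply hrn), sigma, mul_pow, rho,
    Real.sq_sqrt (by positivity)]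
  field_simp
  ring

/-- Trace zero determines `y` from `x`, unit speed determines `x²`, and `y < x` fixes the sign. -/
theorem eq_rho_sigma {n r : ℕ} (hr0 : 0 < r) (hrn : r < n) {p : Fin n → Prop} [DecidablePred p]
    (hp : Fintype.card {i // p i} = r) {Λ : traceZero n} {x y : ℝ}
    (hΛ : ∀ i, Λ.1 i = if p i then x else y) (hN : 2 * Real.sqrt n * ‖Λ‖ = 1) (hxy : y < x) :
    x = rho n r ∧ y = sigma n r := by
  have h1 : (0 : ℝ) < r := by exact_mod_cast hr0
  have h2 : (0 : ℝ) < n - r := sub_pos.2 (by exact_mod_cast hrn)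
  have h3 : (0 : ℝ) < n := by linarith
  have hsum : r * x + ((n : ℝ) - r) * y = 0 := by
    rw [← sum_ite_eq_of_card hp]
    have h : ∑ i, Λ.1 i = 0 := Λ.2
    simpa only [hΛ] using h
  have hy : y = -((r : ℝ) / ((n : ℝ) - r)) * x := by
    field_simp
    linarith
  have hx0 : 0 < x := by
    by_contra hx
    have : r * x ≤ 0 := mul_nonpos_of_nonneg_of_nonpos h1.le (not_lt.1 hx)
    have : ((n : ℝ) - r) * y < 0 := mul_neg_of_pos_of_neg h2 (hxy.trans_le (not_lt.1 hx))
    linarith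
  have hsq := sq_norm_of_two_valued hp hΛ
  rw [hN, hy] at hsq
  have hx : x = rho n r := by
    rw [rho]
    symm
    rw [Real.sqrt_eq_iff_mul_self_eq (by positivity) hx0.le]
    field_simp at hsq ⊢
    nlinarith
  exact ⟨hx, by rw [hy, hx, sigma]⟩

theorem isOrthonormalBasisOf_congr {n : ℕ} {W : Submodule ℂ (Fin n → ℂ)} (c : MetricClass W)
    (g : SLn n) {p q : Fin n → Prop} (hpq : ∀ i, p i ↔ q i) :
    IsOrthonormalBasisOf c (fun i : {i // p i} =>
      (g : Matrix (Fin n) (Fin n) ℂ) *ᵥ Pi.single i.1 1) ↔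
    IsOrthonormalBasisOf c (fun i : {i // q i} =>
      (g : Matrix (Fin n) (Fin n) ℂ) *ᵥ Pi.single i.1 1) := by
  obtain rfl : p = q := funext fun i => propext (hpq i)
  rfl

theorem isAdapted_iff {n r : ℕ} {W W' : Submodule ℂ (Fin n → ℂ)} (c : MetricClass W)
    (c' : MetricClass W') (g : SLn n) : IsAdapted r c c' g ↔
    (∃ h : HermitianMetric W, Quotient.mk (homothetySetoid W) h = c ∧
      IsFrame h g fun i => (i : ℕ) < r) ∧
    ∃ h' : HermitianMetric W', Quotient.mk (homothetySetoid W') h' = c' ∧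
      IsFrame h' g fun i => ¬ (i : ℕ) < r := by
  rw [← isOrthonormalBasisOf_iff, ← isOrthonormalBasisOf_iff, IsAdapted,
    isOrthonormalBasisOf_congr c' g (p := fun i => r ≤ (i : ℕ)) fun i => not_lt.symm]

theorem exists_isAdapted {n r : ℕ} (hrn : r < n) {W W' : Submodule ℂ (Fin n → ℂ)}
    (hWW' : IsCompl W W') (hr : Module.finrank ℂ W = r) (c : MetricClass W)
    (c' : MetricClass W') : ∃ g : SLn n, IsAdapted r c c' g := by
  obtain ⟨h, rfl⟩ := Quotient.exists_rep c
  obtain ⟨h', rfl⟩ := Quotient.exists_rep c'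
  obtain ⟨b₀, hb₀⟩ := h.exists_orthonormal_basis
  obtain ⟨b₀', hb₀'⟩ := h'.exists_orthonormal_basis
  have hr' : Module.finrank ℂ W' = n - r := by
    have := Submodule.finrank_add_eq_of_isCompl hWW'
    rw [hr, Module.finrank_fin_fun] at this
    omega
  have hcard : Fintype.card (Fin (Module.finrank ℂ W)) =
      Fintype.card {i : Fin n // (i : ℕ) < r} := by
    rw [card_subtype_lt hrn, Fintype.card_fin, hr]
  have hcard' : Fintype.card (Fin (Module.finrank ℂ W')) =
      Fintype.card {i : Fin n // ¬ (i : ℕ) < r} := by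
    rw [Fintype.card_subtype_compl, card_subtype_lt hrn, Fintype.card_fin, Fintype.card_fin, hr']
  set b := b₀.reindex (Fintype.equivOfCardEq hcard) with hb
  set b' := b₀'.reindex (Fintype.equivOfCardEq hcard') with hb'
  have hbo : ∀ i j, h.form (b i) (b j) = if i = j then 1 else 0 := fun i j => by
    rw [hb, Module.Basis.reindex_apply, Module.Basis.reindex_apply, hb₀]
    simp only [EmbeddingLike.apply_eq_iff_eq]
  have hbo' : ∀ i j, h'.form (b' i) (b' j) = if i = j then 1 else 0 := fun i j => by
    rw [hb', Module.Basis.reindex_apply, Module.Basis.reindex_apply, hb₀']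
    simp only [EmbeddingLike.apply_eq_iff_eq]
  let B : Module.Basis (Fin n) ℂ (Fin n → ℂ) :=
    ((b.prod b').map (Submodule.prodEquivOfIsCompl W W' hWW')).reindex
      (Equiv.sumCompl fun i : Fin n => (i : ℕ) < r)
  have hB : ∀ i : {i : Fin n // (i : ℕ) < r}, B i = b i := fun i => by
    simp [B]
  have hB' : ∀ i : {i : Fin n // ¬ (i : ℕ) < r}, B i = b' i := fun i => by
    simp [B]
  set M : Matrix (Fin n) (Fin n) ℂ := (Pi.basisFun ℂ (Fin n)).toMatrix B with hM
  have hMcol : ∀ i, M *ᵥ Pi.single i 1 = B i := fun i => by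
    rw [Matrix.mulVec_single_one]
    ext j
    simp [hM, Module.Basis.toMatrix_apply]
  have hdet : M.det ≠ 0 := by
    have := (Pi.basisFun ℂ (Fin n)).isUnit_det B
    rw [Module.Basis.det_apply] at this
    exact this.ne_zero
  -- Scaling all columns by an `n`-th root of the inverse determinant lands in SL. It rescales both
  -- metrics by `|s|⁻²`, which homothety classes do not see.
  obtain ⟨s, hs⟩ := IsAlgClosed.exists_pow_nat_eq (M.det)⁻¹ (n := n) (by omega)
  have hs0 : s ≠ 0 := by
    rintro rfl
    rw [zero_pow (by omega)] at hs
    exact inv_ne_zero hdet hs.symm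
  let g : SLn n := ⟨s • M, by
    rw [Matrix.det_smul, Fintype.card_fin, hs, inv_mul_cancel₀ hdet]⟩
  have hg : ∀ i, (g : Matrix (Fin n) (Fin n) ℂ) *ᵥ Pi.single i 1 = s • B i := fun i => by
    change (s • M) *ᵥ Pi.single i 1 = s • B i
    rw [Matrix.smul_mulVec, hMcol]
  have hs2 : 0 < (Complex.normSq s)⁻¹ := inv_pos.2 (Complex.normSq_pos.2 hs0)
  have hcancel : ((((Complex.normSq s)⁻¹ : ℝ) : ℂ)) * (conj s * s) = 1 := by
    rw [← Complex.normSq_eq_conj_mul_self, ← Complex.ofReal_mul,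
      inv_mul_cancel₀ (Complex.normSq_pos.2 hs0).ne', Complex.ofReal_one]
  have hscale : ∀ {V : Type} [AddCommGroup V] [Module ℂ V] (k : HermitianMetric V) (v w : V),
      (k.scale hs2).form (s • v) (s • w) = k.form v w := by
    intro V _ _ k v w
    change ((((Complex.normSq s)⁻¹ : ℝ) : ℂ) • k.form) (s • v) (s • w) = _
    rw [LinearMap.smul_apply, LinearMap.smul_apply, map_smul, LinearMap.map_smulₛₗ, LinearMap.smul_apply,
      smul_eq_mul, smul_eq_mul, smul_eq_mul]
    linear_combination (k.form v w) * hcancel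
  refine ⟨g, (isAdapted_iff _ _ g).2 ⟨⟨h.scale hs2, ?_, ?_⟩, ⟨h'.scale hs2, ?_, ?_⟩⟩⟩
  · exact (Quotient.sound (⟨_, hs2, fun _ _ => rfl⟩ : homothetySetoid W h (h.scale hs2))).symm
  · refine (isFrame_iff _ _ _).2 ⟨b.map (LinearEquiv.smulOfNeZero ℂ W s hs0), fun i => ?_,
      fun i j => ?_⟩
    · rw [hg, hB]; rfl
    · rw [← hbo i j]
      exact hscale h (b i) (b j)
  · exact (Quotient.sound (⟨_, hs2, fun _ _ => rfl⟩ : homothetySetoid W' h' (h'.scale hs2))).symm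
  · refine (isFrame_iff _ _ _).2 ⟨b'.map (LinearEquiv.smulOfNeZero ℂ W' s hs0), fun i => ?_,
      fun i j => ?_⟩
    · rw [hg, hB']; rfl
    · rw [← hbo' i j]
      exact hscale h' (b' i) (b' j)

theorem exists_geodesic_joins {n r : ℕ} (hr0 : 0 < r) (hrn : r < n)
    {W W' : Submodule ℂ (Fin n → ℂ)} {g : SLn n} (hW : W = colSpan g fun i => (i : ℕ) < r)
    (hW' : W' = colSpan g fun i => ¬ (i : ℕ) < r) :
    ∃ γ : Geodesic n, γ.1 = stdCurve hrn g ∧ γ.Joins W W' := by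
  have hn : n ≠ 0 := by omega
  let γ : Geodesic n :=
    ⟨_, isUnitSpeedGeodesic_tau_mul_diagExp g (norm_rhoSigma hr0 hrn)⟩
  have hγ : ∀ t, γ.1 t = tau (g * diagExp (t • rhoSigma n r hrn)) := fun t => rfl
  have hσρ : sigma n r < rho n r := (sigma_neg hr0 hrn).trans (rho_pos hr0 hrn)
  -- The vanishing pattern at `+∞` is thus the block pattern of the stabilizer of W, and at `-∞` the
  -- opposite block, which is that of W'.
  have hlt : ∀ i j, (rhoSigma n r hrn).1 i < (rhoSigma n r hrn).1 j ↔
      ¬ (i : ℕ) < r ∧ (j : ℕ) < r := fun i j => by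
    rw [rhoSigma_apply, rhoSigma_apply]
    split_ifs with hi hj hj
    · simp [hi]
    · simp only [hi, not_true_eq_false, false_and, iff_false, not_lt]; exact hσρ.le
    · simp [hi, hj, hσρ]
    · simp [hj]
  refine ⟨γ, funext fun t => (hγ t).trans (stdCurve_eq hrn g t).symm, Or.inl ⟨?_, ?_⟩⟩
  · rw [isBoundaryPointOf_endPos_iff hn hγ, hW]
    intro a
    rw [map_colSpan_eq_iff]
    simp only [hlt, and_imp]
  · rw [isBoundaryPointOf_endNeg_iff hn hγ, hW']
    intro a
    rw [map_colSpan_eq_iff]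
    simp only [hlt, and_imp, not_not]
    exact ⟨fun H i j hi hj => H i j hj hi, fun H i j hj hi => H i j hi hj⟩

/-- A curve `g exp(t Λ) u` with the right stabilizers at infinity comes from a pair of
complementary column spaces. -/
theorem exists_colSpan_of_stabilizers {n r : ℕ} (hr0 : 0 < r) (hrn : r < n)
    {W W' : Submodule ℂ (Fin n → ℂ)} (hr : Module.finrank ℂ W = r) {g : SLn n}
    {Λ : traceZero n} (hN : 2 * Real.sqrt n * ‖Λ‖ = 1)
    (h : ∀ a : SLn n,
      (∀ i j, Λ.1 i < Λ.1 j → ((g⁻¹ * a * g : SLn n) : Matrix (Fin n) (Fin n) ℂ) i j = 0) ↔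
        W.map (Matrix.toLin' (a : Matrix (Fin n) (Fin n) ℂ)) = W)
    (h' : ∀ a : SLn n,
      (∀ i j, Λ.1 j < Λ.1 i → ((g⁻¹ * a * g : SLn n) : Matrix (Fin n) (Fin n) ℂ) i j = 0) ↔
        W'.map (Matrix.toLin' (a : Matrix (Fin n) (Fin n) ℂ)) = W') :
    ∃ (p : Fin n → Prop) (_ : DecidablePred p), W = colSpan g p ∧
      W' = colSpan g (fun i => ¬ p i) ∧ ∀ i, Λ.1 i = if p i then rho n r else sigma n r := by
  classical
  have hne : ∃ i j, Λ.1 i < Λ.1 j := by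
    by_contra! hcon
    have hconst : ∀ i j, Λ.1 i = Λ.1 j := fun i j => le_antisymm (hcon j i) (hcon i j)
    have hzero : Λ = 0 := by
      apply Subtype.ext
      ext i
      have hs : ∑ j, Λ.1 j = 0 := Λ.2
      rw [Finset.sum_congr rfl fun j _ => hconst j i, Finset.sum_const, Finset.card_univ,
        Fintype.card_fin, nsmul_eq_mul, mul_eq_zero] at hs
      exact hs.resolve_left (by exact_mod_cast (by omega : n ≠ 0))
    rw [hzero, norm_zero, mul_zero] at hN
    exact zero_ne_one hN
  obtain ⟨hW, hp⟩ := eq_colSpan_of_stabilizer hne h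
  -- The end at `-∞` is governed by `-Λ`, so W' is spanned by the columns whose value is not
  -- maximal.
  obtain ⟨hW', hp'⟩ := eq_colSpan_of_stabilizer (Λ := fun i => -Λ.1 i) (W := W') (g := g)
    (by obtain ⟨i, j, hij⟩ := hne; exact ⟨j, i, neg_lt_neg hij⟩)
    (by simpa only [neg_lt_neg_iff] using h')
  simp only [neg_lt_neg_iff, neg_inj] at hW' hp'
  obtain ⟨i₀, j₀, h₀⟩ := hne
  set p : Fin n → Prop := fun i => ∃ j, Λ.1 j < Λ.1 i with hpdef
  -- All non-minimal values coincide, so being non-minimal is the same as being maximal.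
  have hpq : (fun i => ∃ j, Λ.1 i < Λ.1 j) = fun i => ¬ p i := by
    ext i
    constructor
    · rintro ⟨j, hj⟩ hi
      exact hj.ne (hp i j hi ⟨i, hj⟩)
    · intro hi
      by_contra! hcon
      exact hi ⟨i₀, h₀.trans_le (hcon j₀)⟩
  rw [hpq] at hW'
  have hpi₀ : ∃ j, Λ.1 i₀ < Λ.1 j := ⟨j₀, h₀⟩
  have hval : ∀ i, Λ.1 i = if p i then Λ.1 j₀ else Λ.1 i₀ := fun i => by
    split_ifs with hi
    · exact hp i j₀ hi ⟨i₀, h₀⟩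
    · exact hp' i i₀ ((congrFun hpq i).mpr hi) hpi₀
  have hcard : Fintype.card {i // p i} = r := by
    rw [← finrank_colSpan g p, ← hr, hW]
  obtain ⟨e1, e2⟩ := eq_rho_sigma hr0 hrn hcard hval hN h₀
  refine ⟨p, inferInstance, hW, hW', fun i => ?_⟩
  rw [← e1, ← e2]
  exact hval i

/-- The index set `p` is arbitrary because the columns of a given geodesic need not come in the
order W, W'. The lemma serves both independence of the adapted element and surjectivity. -/
theorem rel_of_isAdapted {n r : ℕ} (hr0 : 0 < r) (hrn : r < n)
    {W W' : Submodule ℂ (Fin n → ℂ)} {h : HermitianMetric W} {h' : HermitianMetric W'}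
    {g g₁ : SLn n} {p : Fin n → Prop} [DecidablePred p] (hp : ∃ i, p i) {Λ : traceZero n}
    (hΛ : ∀ i, Λ.1 i = if p i then rho n r else sigma n r)
    (hf : IsFrame h g p) (hf' : IsFrame h' g fun i => ¬ p i)
    (hg₁ : IsAdapted r (Quotient.mk (homothetySetoid W) h) (Quotient.mk (homothetySetoid W') h')
      g₁) :
    ∃ s : ℝ, ∀ t : ℝ, stdCurve hrn g₁ t = tau (g * diagExp ((t + s) • Λ)) := by
  obtain ⟨⟨h₁, e₁, hf₁⟩, ⟨h₁', e₁', hf₁'⟩⟩ := (isAdapted_iff _ _ _).1 hg₁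
  obtain ⟨c, hc, hh⟩ := Quotient.exact e₁.symm
  obtain ⟨c', hc', hh'⟩ := Quotient.exact e₁'.symm
  simp only [stdCurve_eq]
  exact exists_shift (rho_pos hr0 hrn).ne' hp hΛ (rhoSigma_apply hrn) (inv_pos.2 hc)
    (inv_pos.2 hc') (hf.frameGram_eq_smul hf₁ hc hh) (hf'.frameGram_eq_smul hf₁' hc' hh')

/-- A single common point, at any two parameters, already determines the classes, so the form of the
reparametrization is irrelevant for injectivity. -/
theorem eq_of_isAdapted_of_stdCurve_eq {n r : ℕ} (hrn : r < n)
    {W W' : Submodule ℂ (Fin n → ℂ)} (hWW' : IsCompl W W') {c c₁ : MetricClass W}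
    {c' c₁' : MetricClass W'} {g g₁ : SLn n} (hg : IsAdapted r c c' g)
    (hg₁ : IsAdapted r c₁ c₁' g₁) {t t₁ : ℝ} (h : stdCurve hrn g t = stdCurve hrn g₁ t₁) :
    c = c₁ ∧ c' = c₁' := by
  obtain ⟨⟨k, rfl, hf⟩, ⟨k', rfl, hf'⟩⟩ := (isAdapted_iff _ _ _).1 hg
  obtain ⟨⟨k₁, rfl, hf₁⟩, ⟨k₁', rfl, hf₁'⟩⟩ := (isAdapted_iff _ _ _).1 hg₁
  rw [stdCurve_eq, stdCurve_eq] at h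
  obtain ⟨α, β, hα, hβ, hP, hP'⟩ := exists_frameGram_eq_smul hWW' (rhoSigma_apply hrn)
    (rhoSigma_apply hrn) hf.1 hf'.1 hf₁.1 hf₁'.1 h
  exact ⟨Quotient.sound ⟨α, hα, hf.form_eq_of_frameGram_eq_smul hf₁ hP⟩,
    Quotient.sound ⟨β, hβ, hf'.form_eq_of_frameGram_eq_smul hf₁' hP'⟩⟩

/-- The sign `ε = ±1` absorbs the two orders of the end points: a geodesic that runs from W to W' is
reversed by passing to `-Λ`. -/
theorem Geodesic.Joins.exists_colSpan {n r : ℕ} (hr0 : 0 < r) (hrn : r < n)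
    {W W' : Submodule ℂ (Fin n → ℂ)} (hr : Module.finrank ℂ W = r) {γ : Geodesic n}
    (hγ : γ.Joins W W') :
    ∃ (g : SLn n) (Λ : traceZero n) (ε : ℝ) (p : Fin n → Prop) (_ : DecidablePred p), ε ≠ 0 ∧
      W = colSpan g p ∧ W' = colSpan g (fun i => ¬ p i) ∧
      (∀ i, Λ.1 i = if p i then rho n r else sigma n r) ∧
      ∀ t, tau (g * diagExp (t • Λ)) = γ.1 (ε * t) := by
  have hn : n ≠ 0 := by omega
  obtain ⟨g, Λ, hN, hγΛ⟩ := γ.exists_eq hn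
  rcases hγ with ⟨h1, h2⟩ | ⟨h1, h2⟩
  · rw [isBoundaryPointOf_endPos_iff hn hγΛ] at h1
    rw [isBoundaryPointOf_endNeg_iff hn hγΛ] at h2
    obtain ⟨p, hdec, hW, hW', hval⟩ := exists_colSpan_of_stabilizers hr0 hrn hr hN h1 h2
    exact ⟨g, Λ, 1, p, hdec, one_ne_zero, hW, hW', hval, fun t => by rw [one_mul, hγΛ]⟩
  · rw [isBoundaryPointOf_endPos_iff hn hγΛ] at h1
    rw [isBoundaryPointOf_endNeg_iff hn hγΛ] at h2
    obtain ⟨p, hdec, hW, hW', hval⟩ := exists_colSpan_of_stabilizers (Λ := -Λ) (g := g)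
      hr0 hrn hr (by rwa [norm_neg])
      (by simpa only [Submodule.coe_neg, PiLp.neg_apply, neg_lt_neg_iff] using h2)
      (by simpa only [Submodule.coe_neg, PiLp.neg_apply, neg_lt_neg_iff] using h1)
    exact ⟨g, -Λ, -1, p, hdec, by norm_num, hW, hW', hval, fun t => by
      rw [hγΛ, smul_neg, ← neg_smul, neg_one_mul]⟩

end

end SLSym

theorem proposition4p9 (n r : ℕ) (hr0 : 0 < r) (hrn : r < n)
    (W W' : Submodule ℂ (Fin n → ℂ)) (hWW' : IsCompl W W') (hr : Module.finrank ℂ W = r) :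
    (∀ (c : SLSym.MetricClass W) (c' : SLSym.MetricClass W'),
      ∃ g : SLSym.SLn n, SLSym.IsAdapted r c c' g) ∧
    (∀ (c : SLSym.MetricClass W) (c' : SLSym.MetricClass W') (g : SLSym.SLn n),
      SLSym.IsAdapted r c c' g →
        ∃ γ : SLSym.Geodesic n, γ.1 = SLSym.stdCurve hrn g ∧ γ.Joins W W') ∧
    (∃ Φ : SLSym.MetricClass W × SLSym.MetricClass W' → SLSym.JoiningGeodesics W W',
      Function.Bijective Φ ∧
      ∀ (c : SLSym.MetricClass W) (c' : SLSym.MetricClass W') (g : SLSym.SLn n)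
        (γ : SLSym.Geodesic n) (hγ : γ.Joins W W'),
        SLSym.IsAdapted r c c' g → γ.1 = SLSym.stdCurve hrn g →
          Φ (c, c') = Quotient.mk (SLSym.reparamSetoid W W') ⟨γ, hγ⟩) := by
  open SLSym in
  have exists_adapted := fun c c' => exists_isAdapted hrn hWW' hr c c'
  have exists_joining : ∀ (c : MetricClass W) (c' : MetricClass W') (g : SLn n), IsAdapted r c c' g →
      ∃ γ : Geodesic n, γ.1 = stdCurve hrn g ∧ γ.Joins W W' := by
    intro c c' g hg
    obtain ⟨⟨h, -, hf⟩, ⟨h', -, hf'⟩⟩ := (isAdapted_iff _ _ _).1 hg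
    exact exists_geodesic_joins hr0 hrn hf.1 hf'.1
  refine ⟨exists_adapted, exists_joining, ?_⟩
  choose G hG using exists_adapted
  choose Γ hΓ hΓJ using fun c c' => exists_joining c c' (G c c') (hG c c')
  refine ⟨fun cc => Quotient.mk (reparamSetoid W W') ⟨Γ cc.1 cc.2, hΓJ cc.1 cc.2⟩,
    ⟨?_, ?_⟩, ?_⟩
  · rintro ⟨c, c'⟩ ⟨c₁, c₁'⟩ h
    obtain ⟨a, b, -, hab⟩ := Quotient.exact h
    have h0 : (Γ c₁ c₁').1 0 = (Γ c c').1 (a * 0 + b) := hab 0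
    rw [hΓ, hΓ] at h0
    obtain ⟨e, e'⟩ := eq_of_isAdapted_of_stdCurve_eq hrn hWW' (hG _ _) (hG _ _) h0
    exact Prod.ext e.symm e'.symm
  · intro q
    obtain ⟨⟨γ, hγ⟩, rfl⟩ := Quotient.exists_rep q
    obtain ⟨g, Λ, ε, p, hdec, hε, hW, hW', hval, hcurve⟩ := hγ.exists_colSpan hr0 hrn hr
    have hp : ∃ i, p i := by
      have hcard : Fintype.card {i // p i} = r := by rw [← finrank_colSpan g p, ← hW, hr]
      obtain ⟨i⟩ := Fintype.card_pos_iff.1 (hcard.symm ▸ hr0)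
      exact ⟨i.1, i.2⟩
    -- The preimage consists of the metrics for which the columns of `g` are orthonormal.
    refine ⟨(Quotient.mk _ (pullbackMetric g W), Quotient.mk _ (pullbackMetric g W')), ?_⟩
    obtain ⟨s, hs⟩ := rel_of_isAdapted hr0 hrn hp hval (isFrame_pullbackMetric hW)
      (isFrame_pullbackMetric hW')
      (hG (Quotient.mk _ (pullbackMetric g W)) (Quotient.mk _ (pullbackMetric g W')))
    refine (Quotient.sound (s := reparamSetoid W W') (a := ⟨γ, hγ⟩) (b := ⟨Γ _ _, hΓJ _ _⟩)
      ⟨ε, ε * s, hε, fun t => ?_⟩).symm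
    change (Γ _ _).1 t = γ.1 (ε * t + ε * s)
    rw [hΓ, hs, hcurve, mul_add]
  · intro c c' g γ hγ hg hγg
    obtain ⟨⟨h, hc, hf⟩, ⟨h', hc', hf'⟩⟩ := (isAdapted_iff _ _ _).1 hg
    have hGcc := hG c c'
    -- Both the given `g` and the chosen `G c c'` are adapted to the same classes, so their curves
    -- differ by a shift of the parameter.
    obtain ⟨s, hs⟩ := rel_of_isAdapted hr0 hrn ⟨⟨0, by omega⟩, hr0⟩ (rhoSigma_apply hrn) hf hf'
      (g₁ := G c c') (by rw [hc, hc']; exact hGcc)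
    refine (Quotient.sound (s := reparamSetoid W W') (a := ⟨γ, hγ⟩) (b := ⟨Γ c c', hΓJ c c'⟩)
      ⟨1, s, one_ne_zero, fun t => ?_⟩).symm
    change (Γ c c').1 t = γ.1 (1 * t + s)
    rw [hΓ, hs, hγg, stdCurve_eq, one_mul]
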